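/- Let $n\ge 0$ be an integer and let $\mathbb T^n=(\mathbb R/\mathbb Z)^n$ with its normalized Haar measure. For $f:\mathbb Z^n\to\mathbb C$ put $\Delta_{k_j}f(k)=f(k+e_j)-f(k)$ and $\Delta_k^\alpha=\Delta_{k_1}^{\alpha_1}\cdots\Delta_{k_n}^{\alpha_n}$ for $\alpha\in\mathbb N_0^n$. On $C^\infty(\mathbb T^n)$ put $D_{x_j}=\frac1{2\pi i}\frac{\partial}{\partial x_j}$, $D_{x_j}^{(0)}=I$, $D_{x_j}^{(\ell)}=\prod_{r=0}^{\ell-1}(D_{x_j}-r)$ for $\ell\ge1$, and $D_x^{(\alpha)}=D_{x_1}^{(\alpha_1)}\cdots D_{x_n}^{(\alpha_n)}$. Let $\Lambda:\mathbb Z^n\to\mathbb R$ be a weight function: there are constants $0<\mu_0\le\mu_1\le\mu$ and $C_0,C_1>0$ with $C_0(1+|k|)^{\mu_0}\le\Lambda(k)\le C_1(1+|k|)^{\mu_1}$ for all $k\in\mathbb Z^n$, and for all $\alpha\in\mathbb N_0^n$, $\gamma\in\{0,1\}^n$ there is $C_{\alpha,\gamma}>0$ with $|k^\gamma\Delta_k^{\alpha+\gamma}\Lambda(k)|\le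 C_{\alpha,\gamma}\Lambda(k)^{1-|\alpha|/\mu}$ for all $k$. Let $0<\rho\le 1/\mu$. For $m\in\mathbb R$ let $S^m_{\rho,\Lambda}$ be the set of $\sigma:\mathbb Z^n\times\mathbb T^n\to\mathbb C$ such that $\sigma(k,\cdot)\in C^\infty(\mathbb T^n)$ for every $k$, and for all $\alpha,\beta\in\mathbb N_0^n$ there is $C_{\alpha,\beta}>0$ with $|D_x^{(\beta)}\Delta_k^\alpha\sigma(k,x)|\le C_{\alpha,\beta}\Lambda(k)^{m-\rho|\alpha|}$ for all $(k,x)$. Let $M^m_{\rho,\Lambda}$ be the set of $\sigma:\mathbb Z^n\times\mathbb T^n\to\mathbb C$, smooth in $x$ for every $k$, with $k^\gamma\Delta_k^\gamma\sigma(k,x)\in S^m_{\rho,\Lambda}$ for all $\gamma\in\{0,1\}^n$. Let $\mathcal S(\mathbb Z^n)$ be the space of rapidly decreasing functions on $\mathbb Z^n$. For $f\in\mathcal S(\mathbb Z^n)$ put $\widehat f(x)=\sum_{k\in\mathbb Z^n}e^{-2\pi i k\cdot x}f(k)$ and $$(T_\sigma f)(k)=\int_{\mathbb T^n}e^{2\pi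 i k\cdot x}\sigma(k,x)\widehat f(x)\,dx,\qquad k\in\mathbb Z^n.$$ **Theorem (Transpose operators).** Let $m\in\mathbb R$ and $\sigma\in M^m_{\rho,\Lambda}$. Then there is a symbol $\sigma^t\in M^m_{\rho,\Lambda}$ such that $T_{\sigma^t}$ is the transpose of $T_\sigma$ on $\mathcal S(\mathbb Z^n)$. That is, for all $f,g\in\mathcal S(\mathbb Z^n)$ both of the following series converge absolutely and $$\sum_{k\in\mathbb Z^n}(T_{\sigma^t}f)(k)\,g(k)=\sum_{k\in\mathbb Z^n}f(k)\,(T_\sigma g)(k),$$ and any map $B$ on functions satisfying this identity for all $f,g\in\mathcal S(\mathbb Z^n)$ (with absolutely convergent series) in place of $T_{\sigma^t}$ agrees with $T_{\sigma^t}$ on $\mathcal S(\mathbb Z^n)$. Moreover $\sigma^t(k,x)\sim\sum_\alpha\frac1{\alpha!}\Delta_k^\alpha D_x^{(\alpha)}[\sigma(k,-x)]$, where $D_x^{(\alpha)}$ acts on the function $x\mapsto\sigma(k,-x)$, in the sense that for every integer $N\ge 0$ $$\sigma^t(k,x)-\sum_{|\alpha|<N}\frac1{\alpha!}\Delta_k^\alpha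 D_x^{(\alpha)}[\sigma(k,-x)]\in M^{m-\rho N}_{\rho,\Lambda}.$$ -/

import Mathlib

namespace LatticePDO

noncomputable section

/-! ### Difference operators on the lattice `ℤⁿ` -/

/-- The forward difference `(Δ_{k_j} f)(k) = f(k + e_j) - f(k)`. -/
def diff {n : ℕ} {E : Type*} [AddCommGroup E] (j : Fin n) (f : (Fin n → ℤ) → E) :
    (Fin n → ℤ) → E :=
  fun k => f (k + Pi.single j 1) - f k

/-- `Δ_k^α = Δ_{k_1}^{α_1} ⋯ Δ_{k_n}^{α_n}`. -/
def diffMulti {n : ℕ} {E : Type*} [AddCommGroup E] (α : Fin n → ℕ) (f : (Fin n → ℤ) → E) :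
    (Fin n → ℤ) → E :=
  (List.finRange n).foldr (fun j g => (diff j)^[α j] g) f

/-- The length `|α| = α_1 + ⋯ + α_n` of a multi-index. -/
def mlen {n : ℕ} (α : Fin n → ℕ) : ℕ := ∑ i, α i

/-- The multi-index factorial `α! = α_1! ⋯ α_n!`. -/
def mfact {n : ℕ} (α : Fin n → ℕ) : ℕ := ∏ i, (α i).factorial

/-- The multi-indices `α ∈ ℕ₀ⁿ` with `|α| < N`. -/
def multiIdxLT (n N : ℕ) : Finset (Fin n → ℕ) :=
  (Fintype.piFinset fun _ : Fin n => Finset.range N).filter fun α => mlen α < N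

/-- The Euclidean length `|k|` of a lattice point. -/
def znorm {n : ℕ} (k : Fin n → ℤ) : ℝ := Real.sqrt (∑ i, (k i : ℝ) ^ 2)

/-- The monomial `k^γ = k_1^{γ_1} ⋯ k_n^{γ_n}`. -/
def zpowMulti {n : ℕ} (k : Fin n → ℤ) (γ : Fin n → ℕ) : ℤ := ∏ i, k i ^ γ i

/-! ### Calculus on the torus `𝕋ⁿ = (ℝ/ℤ)ⁿ` -/

/-- `u ∈ C^∞(𝕋ⁿ)`: the `ℤⁿ`-periodic lift of `u` to `ℝⁿ` is smooth. -/
def SmoothTorus {n : ℕ} (u : UnitAddTorus (Fin n) → ℂ) : Prop :=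
  ContDiff ℝ ((⊤ : ℕ∞) : WithTop ℕ∞) fun y : Fin n → ℝ => u fun i => (y i : UnitAddCircle)

/-- `D_{x_j} u = (1 / 2πi) ∂u/∂x_j`. -/
def torusD {n : ℕ} (j : Fin n) (u : UnitAddTorus (Fin n) → ℂ) : UnitAddTorus (Fin n) → ℂ :=
  fun x => (2 * (Real.pi : ℂ) * Complex.I)⁻¹ *
    deriv (fun t : ℝ => u (x + Pi.single j (t : UnitAddCircle))) 0

/-- The falling power `D_{x_j}^{(ℓ)} = ∏_{m=0}^{ℓ-1} (D_{x_j} - m)`, with `D_{x_j}^{(0)} = I`. -/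
def torusDFall {n : ℕ} (j : Fin n) : ℕ → (UnitAddTorus (Fin n) → ℂ) → UnitAddTorus (Fin n) → ℂ
  | 0, u => u
  | ℓ + 1, u => fun x => torusD j (torusDFall j ℓ u) x - (ℓ : ℂ) * torusDFall j ℓ u x

/-- `D_x^{(β)} = D_{x_1}^{(β_1)} ⋯ D_{x_n}^{(β_n)}`. -/
def torusDMulti {n : ℕ} (β : Fin n → ℕ) (u : UnitAddTorus (Fin n) → ℂ) :
    UnitAddTorus (Fin n) → ℂ :=
  (List.finRange n).foldr (fun j v => torusDFall j (β j) v) u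

/-! ### Weight functions and symbol classes -/

/-- `Λ` is a weight function on `ℤⁿ` of exponent `μ`, i.e. there are `0 < μ₀ ≤ μ₁ ≤ μ` with
`C₀ (1 + |k|)^{μ₀} ≤ Λ(k) ≤ C₁ (1 + |k|)^{μ₁}`, and
`|k^γ Δ_k^{α+γ} Λ(k)| ≤ C_{α,γ} Λ(k)^{1 - |α|/μ}` for all `α ∈ ℕ₀ⁿ`, `γ ∈ {0,1}ⁿ`. -/
structure IsWeight {n : ℕ} (μ : ℝ) (Λ : (Fin n → ℤ) → ℝ) : Prop where
  growth : ∃ μ₀ μ₁ C₀ C₁ : ℝ, 0 < μ₀ ∧ μ₀ ≤ μ₁ ∧ μ₁ ≤ μ ∧ 0 < C₀ ∧ 0 < C₁ ∧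
    ∀ k, C₀ * (1 + znorm k) ^ μ₀ ≤ Λ k ∧ Λ k ≤ C₁ * (1 + znorm k) ^ μ₁
  diff_bound : ∀ α γ : Fin n → ℕ, (∀ i, γ i ≤ 1) → ∃ C : ℝ, 0 < C ∧
    ∀ k, |(zpowMulti k γ : ℝ) * diffMulti (α + γ) Λ k| ≤ C * Λ k ^ (1 - 1 / μ * (mlen α : ℝ))

/-- The symbol class `S^m_{ρ,Λ}(ℤⁿ × 𝕋ⁿ)`. -/
structure SymbolS {n : ℕ} (Λ : (Fin n → ℤ) → ℝ) (ρ m : ℝ)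
    (σ : (Fin n → ℤ) → UnitAddTorus (Fin n) → ℂ) : Prop where
  smooth : ∀ k, SmoothTorus (σ k)
  bound : ∀ α β : Fin n → ℕ, ∃ C : ℝ, 0 < C ∧
    ∀ k x, ‖torusDMulti β (diffMulti α σ k) x‖ ≤ C * Λ k ^ (m - ρ * (mlen α : ℝ))

/-- The symbol class `M^m_{ρ,Λ}(ℤⁿ × 𝕋ⁿ)`: `k^γ Δ_k^γ σ ∈ S^m_{ρ,Λ}` for all `γ ∈ {0,1}ⁿ`. -/
structure SymbolM {n : ℕ} (Λ : (Fin n → ℤ) → ℝ) (ρ m : ℝ)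
    (σ : (Fin n → ℤ) → UnitAddTorus (Fin n) → ℂ) : Prop where
  smooth : ∀ k, SmoothTorus (σ k)
  mem : ∀ γ : Fin n → ℕ, (∀ i, γ i ≤ 1) →
    SymbolS Λ ρ m fun k x => (zpowMulti k γ : ℂ) * diffMulti γ σ k x

/-! ### Operators -/

/-- The Schwartz space `𝓢(ℤⁿ)` of rapidly decreasing functions on the lattice. -/
def RapidlyDecreasing {n : ℕ} (f : (Fin n → ℤ) → ℂ) : Prop :=
  ∀ M : ℕ, ∃ C : ℝ, ∀ k, (1 + znorm k) ^ M * ‖f k‖ ≤ C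

/-- The discrete Fourier transform `f̂(x) = ∑_k e^{-2πi k·x} f(k)`. -/
def latticeFourier {n : ℕ} (f : (Fin n → ℤ) → ℂ) (x : UnitAddTorus (Fin n)) : ℂ :=
  ∑' k : Fin n → ℤ, UnitAddTorus.mFourier (-k) x * f k

/-- The normalized Haar measure on `𝕋ⁿ`. -/
def haarTorus (n : ℕ) : MeasureTheory.Measure (UnitAddTorus (Fin n)) :=
  MeasureTheory.Measure.pi fun _ => AddCircle.haarAddCircle

/-- The operator `(T_σ f)(k) = ∫_{𝕋ⁿ} e^{2πi k·x} σ(k, x) f̂(x) dx`. -/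
def pdo {n : ℕ} (σ : (Fin n → ℤ) → UnitAddTorus (Fin n) → ℂ) (f : (Fin n → ℤ) → ℂ) :
    (Fin n → ℤ) → ℂ :=
  fun k => ∫ x, UnitAddTorus.mFourier k x * σ k x * latticeFourier f x ∂(haarTorus n)

/-- `B` is a transpose of `A` on `𝓢(ℤⁿ)`: `∑_k (B f)(k) g(k) = ∑_k f(k) (A g)(k)`, with both series
absolutely convergent, for all `f, g ∈ 𝓢(ℤⁿ)`. -/
def IsTranspose {n : ℕ} (A B : ((Fin n → ℤ) → ℂ) → (Fin n → ℤ) → ℂ) : Prop :=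
  ∀ f g : (Fin n → ℤ) → ℂ, RapidlyDecreasing f → RapidlyDecreasing g →
    Summable (fun k => B f k * g k) ∧ Summable (fun k => f k * A g k) ∧
      ∑' k, B f k * g k = ∑' k, f k * A g k

end

end LatticePDO

open LatticePDO

namespace LatticePDO

noncomputable section

/-! ### Japanese brackets and moderate weights on the lattice -/

/-! On the Fourier side $T_\sigma$ is an infinite matrix: if $a(k,j)$ denotes the $j$-th Fourier
coefficient of $\sigma(k,\cdot)$, its $(k,l)$ entry is $a(k,l-k)$ (`pdo_eq_tsum`). The transposed
entry is $a(l,k-l)$, so the transpose has the symbol whose $j$-th coefficient at $k$ is $a(k+j,-j)$;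
this is `transposeSymbol`. Absolute convergence of the double sum gives the duality
(`isTranspose_pdo`), and testing against point masses gives uniqueness (`IsTranspose.eq`).

What remains is the effect of the shift $k\mapsto k+j$ on the symbol estimates. First, membership in
$M^m_{\rho,\Lambda}$ is equivalent to a bound of $\Delta_k^{\alpha+\gamma}a(k,j)$ by
$\Lambda(k)^{m-\rho|\alpha|}\prod_i(1+|k_i|)^{-\gamma_i}$, with decay in $j$ faster than any power
(`symbolM_iff`, resting on `symbolS_iff` and `kernelClass_iff`). Second, the shift has the Newton
expansion $g(k+j)=\sum_{|\alpha|<N}\frac{1}{\alpha!}j^{(\alpha)}\Delta^\alpha g(k)+\cdots$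
(`opOrder_newton`). Multiplication of coefficients by the falling factorial $j^{(\alpha)}$ is
exactly $D_x^{(\alpha)}$, and $j\mapsto -j$ is the reflection $x\mapsto -x$, so the Newton terms are
the terms of the asymptotic series.

The remainder is controlled by differences of total order at least $N$ at displaced points, with
factors polynomial in $j$. Since $\Lambda$ is moderate (`IsWeight.moderate`), displacing the weight
also costs only a polynomial in $j$, and the rapid decay absorbs every such loss
(`DecayBound.of_near`). The case $N=0$ shows that the transposed symbol stays in the class. -/

/-- The lattice bracket `1 + ∑ |jᵢ|`. -/
def bracket {n : ℕ} (j : Fin n → ℤ) : ℝ := 1 + ∑ i, |(j i : ℝ)|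

lemma one_le_bracket {n : ℕ} (j : Fin n → ℤ) : 1 ≤ bracket j := by
  have : 0 ≤ ∑ i, |(j i : ℝ)| := Finset.sum_nonneg fun i _ => abs_nonneg _
  unfold bracket
  linarith

lemma bracket_pos {n : ℕ} (j : Fin n → ℤ) : 0 < bracket j := zero_lt_one.trans_le (one_le_bracket j)

lemma bracket_neg {n : ℕ} (j : Fin n → ℤ) : bracket (-j) = bracket j := by
  simp [bracket]

lemma one_add_abs_le_bracket {n : ℕ} (j : Fin n → ℤ) (i : Fin n) : 1 + |(j i : ℝ)| ≤ bracket j := by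
  have := Finset.single_le_sum (f := fun i => |(j i : ℝ)|) (fun i _ => abs_nonneg _)
    (Finset.mem_univ i)
  unfold bracket
  linarith

lemma abs_le_bracket {n : ℕ} (j : Fin n → ℤ) (i : Fin n) : |(j i : ℝ)| ≤ bracket j := by
  linarith [one_add_abs_le_bracket j i]

lemma bracket_single {n : ℕ} (i : Fin n) (s : ℤ) :
    bracket (Pi.single i s : Fin n → ℤ) = 1 + |(s : ℝ)| := by
  unfold bracket
  rw [Finset.sum_eq_single i]
  · simp
  · intro b _ hb
    simp [hb]
  · simp

lemma znorm_nonneg {n : ℕ} (k : Fin n → ℤ) : 0 ≤ znorm k := Real.sqrt_nonneg _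

lemma abs_le_znorm {n : ℕ} (k : Fin n → ℤ) (i : Fin n) : |(k i : ℝ)| ≤ znorm k := by
  rw [← Real.sqrt_sq_eq_abs]
  exact Real.sqrt_le_sqrt (Finset.single_le_sum (f := fun i => (k i : ℝ) ^ 2)
    (fun i _ => sq_nonneg _) (Finset.mem_univ i))

lemma bracket_le_znorm {n : ℕ} (k : Fin n → ℤ) : bracket k ≤ (n + 1) * (1 + znorm k) := by
  have h : ∑ i, |(k i : ℝ)| ≤ ∑ _i : Fin n, znorm k :=
    Finset.sum_le_sum fun i _ => abs_le_znorm k i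
  have := znorm_nonneg k
  simp at h
  unfold bracket
  nlinarith

lemma znorm_le_bracket {n : ℕ} (k : Fin n → ℤ) : 1 + znorm k ≤ bracket k := by
  unfold bracket znorm
  gcongr
  apply Real.sqrt_le_iff.2 ⟨Finset.sum_nonneg fun i _ => abs_nonneg _, ?_⟩
  simpa using Finset.sum_sq_le_sq_sum_of_nonneg (s := Finset.univ)
    (f := fun i => |(k i : ℝ)|) fun i _ => abs_nonneg _

lemma summable_prod_pi {f : ℤ → ℝ} (hf : ∀ s, 0 ≤ f s) (h : Summable f) :
    ∀ n : ℕ, Summable fun k : Fin n → ℤ => ∏ i, f (k i)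
  | 0 => Summable.of_finite
  | n + 1 => by
    have ih := summable_prod_pi hf h n
    have := h.mul_of_nonneg ih hf fun k => Finset.prod_nonneg fun i _ => hf _
    rw [← (Fin.consEquiv fun _ => ℤ).summable_iff]
    convert this using 2 with x
    simp [Fin.prod_univ_succ]

/-- The bracket dominates each $1+|k_i|$, so its power $2n$ dominates $\prod_i(1+|k_i|)^2$, and the
sum splits into one-dimensional convergent series. -/
lemma summable_bracket_inv (n : ℕ) : Summable fun k : Fin n → ℤ => (bracket k ^ (2 * n))⁻¹ := by
  have h1 : Summable fun s : ℤ => ((1 + |(s : ℝ)|) ^ 2)⁻¹ := by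
    have h2 : Summable fun m : ℕ => ((m + 1 : ℝ) ^ 2)⁻¹ := by
      have := (summable_nat_add_iff 1).2 (Real.summable_nat_pow_inv.2 one_lt_two)
      simpa using this
    exact Summable.of_nat_of_neg (h2.congr fun m => by simp [add_comm])
      (h2.congr fun m => by simp [add_comm])
  have := summable_prod_pi (fun s => by positivity) h1 n
  refine Summable.of_nonneg_of_le (fun k => ?_) (fun k => ?_) this
  · have := bracket_pos k
    positivity
  · rw [Finset.prod_inv_distrib]
    refine inv_anti₀ (Finset.prod_pos fun i _ => by positivity) ?_
    calc ∏ i, (1 + |(k i : ℝ)|) ^ 2 ≤ ∏ _i : Fin n, bracket k ^ 2 := by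
          gcongr with i
          exact one_add_abs_le_bracket k i
      _ = bracket k ^ (2 * n) := by simp [pow_mul]

/-- A nonnegative function on the lattice of polynomially bounded relative growth. -/
def Moderate {n : ℕ} (ω : (Fin n → ℤ) → ℝ) : Prop :=
  (∀ k, 0 ≤ ω k) ∧ ∃ C : ℝ, 0 < C ∧ ∃ q : ℕ, ∀ k v, ω (k + v) ≤ C * bracket v ^ q * ω k

lemma Moderate.mul {n : ℕ} {ω ω' : (Fin n → ℤ) → ℝ} (h : Moderate ω) (h' : Moderate ω') :
    Moderate fun k => ω k * ω' k := by
  obtain ⟨h0, C, hC, q, h⟩ := h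
  obtain ⟨h0', C', hC', q', h'⟩ := h'
  refine ⟨fun k => mul_nonneg (h0 k) (h0' k), C * C', by positivity, q + q', fun k v => ?_⟩
  calc ω (k + v) * ω' (k + v) ≤ (C * bracket v ^ q * ω k) * (C' * bracket v ^ q' * ω' k) :=
        mul_le_mul (h k v) (h' k v) (h0' _) ((h0 _).trans (h k v))
    _ = _ := by ring

lemma Moderate.one {n : ℕ} : Moderate fun _ : Fin n → ℤ => (1 : ℝ) :=
  ⟨fun _ => zero_le_one, 1, one_pos, 0, by simp⟩

lemma Moderate.prod {n : ℕ} {ι : Type*} (s : Finset ι) {ω : ι → (Fin n → ℤ) → ℝ}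
    (h : ∀ i ∈ s, Moderate (ω i)) : Moderate fun k => ∏ i ∈ s, ω i k := by
  classical
  induction s using Finset.induction_on with
  | empty => simpa using Moderate.one
  | insert a s ha ih =>
    simp only [Finset.prod_insert ha]
    exact (h a (by simp)).mul (ih fun i hi => h i (by simp [hi]))

lemma Moderate.pow {n : ℕ} {ω : (Fin n → ℤ) → ℝ} (h : Moderate ω) (m : ℕ) :
    Moderate fun k => ω k ^ m := by
  simpa using Moderate.prod (Finset.range m) fun _ _ => h

/-- Moderateness is symmetric: apply the bound at $k+v$ with displacement $-v$. -/
lemma Moderate.inv {n : ℕ} {ω : (Fin n → ℤ) → ℝ} (h : Moderate ω) (hpos : ∀ k, 0 < ω k) :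
    Moderate fun k => (ω k)⁻¹ := by
  obtain ⟨h0, C, hC, q, h⟩ := h
  refine ⟨fun k => inv_nonneg.2 (h0 k), C, hC, q, fun k v => ?_⟩
  have h1 := h (k + v) (-v)
  rw [bracket_neg, add_neg_cancel_right] at h1
  rw [inv_le_iff_one_le_mul₀ (hpos _)]
  calc (1 : ℝ) = ω k * (ω k)⁻¹ := (mul_inv_cancel₀ (hpos k).ne').symm
    _ ≤ (C * bracket v ^ q * ω (k + v)) * (ω k)⁻¹ := by
      gcongr
      exact inv_nonneg.2 (h0 k)
    _ = _ := by ring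

lemma Moderate.rpow {n : ℕ} {ω : (Fin n → ℤ) → ℝ} (h : Moderate ω) (hpos : ∀ k, 0 < ω k) (s : ℝ) :
    Moderate fun k => ω k ^ s := by
  have key : ∀ t : ℝ, 0 ≤ t → Moderate fun k => ω k ^ t := by
    intro t ht
    obtain ⟨h0, C, hC, q, h⟩ := h
    refine ⟨fun k => Real.rpow_nonneg (h0 k) _, C ^ t, by positivity, ⌈q * t⌉₊, fun k v => ?_⟩
    have hb := one_le_bracket v
    calc ω (k + v) ^ t ≤ (C * bracket v ^ q * ω k) ^ t :=
          Real.rpow_le_rpow (h0 _) (h k v) ht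
      _ = C ^ t * bracket v ^ (q * t : ℝ) * ω k ^ t := by
          rw [Real.mul_rpow (by positivity) (h0 k), Real.mul_rpow hC.le (by positivity),
            ← Real.rpow_natCast, ← Real.rpow_mul (by positivity)]
      _ ≤ C ^ t * bracket v ^ ⌈q * t⌉₊ * ω k ^ t := by
          rw [← Real.rpow_natCast (bracket v)]
          gcongr
          · exact Real.rpow_nonneg (h0 k) _
          · exact Nat.le_ceil _
  rcases le_total 0 s with hs | hs
  · exact key s hs
  · have := (key (-s) (by linarith)).inv fun k => Real.rpow_pos_of_pos (hpos k) _
    simpa [Real.rpow_neg (hpos _).le] using this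

lemma moderate_one_add_abs {n : ℕ} (i : Fin n) : Moderate fun k : Fin n → ℤ => 1 + |(k i : ℝ)| := by
  refine ⟨fun k => by positivity, 1, one_pos, 1, fun k v => ?_⟩
  have h1 := one_add_abs_le_bracket v i
  have h2 := abs_add_le (k i : ℝ) (v i : ℝ)
  have h3 := abs_nonneg (k i : ℝ)
  have h4 := abs_nonneg (v i : ℝ)
  simp only [Pi.add_apply, Int.cast_add, one_mul, pow_one]
  nlinarith [mul_nonneg h3 h4]

/-! ### Moderateness of weight functions -/

/-- Telescoping along a lattice path from $k$ to $k+v$ that follows one coordinate axis at a time.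
-/
lemma le_add_mul_sum_abs_of_unit_steps {n : ℕ} {F : (Fin n → ℤ) → ℝ} {A : ℝ}
    (hF : ∀ i k, |F (k + Pi.single i 1) - F k| ≤ A) (k v : Fin n → ℤ) :
    F (k + v) ≤ F k + A * ∑ i, |(v i : ℝ)| := by
  have hnat : ∀ (i : Fin n) (m : ℕ) (k : Fin n → ℤ),
      |F (k + Pi.single i (m : ℤ)) - F k| ≤ A * m := by
    intro i m
    induction m with
    | zero => simp
    | succ m ih =>
      intro k
      have h1 := hF i (k + Pi.single i (m : ℤ))
      have h2 := ih k
      have e : k + Pi.single i ((m + 1 : ℕ) : ℤ) = k + Pi.single i (m : ℤ) + Pi.single i 1 := by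
        push_cast
        rw [Pi.single_add, add_assoc]
      rw [e]
      calc _ ≤ |F (k + Pi.single i (m : ℤ) + Pi.single i 1) - F (k + Pi.single i (m : ℤ))|
            + |F (k + Pi.single i (m : ℤ)) - F k| := abs_sub_le _ _ _
        _ ≤ _ := by push_cast; linarith
  have hint : ∀ (i : Fin n) (s : ℤ) (k : Fin n → ℤ), F (k + Pi.single i s) ≤ F k + A * |(s : ℝ)| := by
    intro i s k
    obtain ⟨m, rfl | rfl⟩ := s.eq_nat_or_neg
    · have := (abs_le.1 (hnat i m k)).2
      simp
      linarith
    -- A backward move is the forward estimate started from its endpoint.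
    · have := (abs_le.1 (hnat i m (k + Pi.single i (-(m : ℤ))))).1
      rw [add_assoc, ← Pi.single_add] at this
      simp at this ⊢
      linarith
  have hfin : ∀ (s : Finset (Fin n)),
      F (k + ∑ i ∈ s, Pi.single i (v i)) ≤ F k + A * ∑ i ∈ s, |(v i : ℝ)| := by
    intro s
    induction s using Finset.induction_on with
    | empty => simp
    | insert a s ha ih =>
      rw [Finset.sum_insert ha, Finset.sum_insert ha, add_comm (Pi.single a _), ← add_assoc]
      have := hint a (v a) (k + ∑ i ∈ s, Pi.single i (v i))
      linarith
  have := hfin Finset.univ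
  rwa [Finset.univ_sum_single] at this

/-- A finite form of $d(x^p)=p\,x^{p-1}dx$: a step of size at most $Cx^{1-p}$ changes $x^p$ by a
bounded amount. The quantity $u=C/x^p$ bounds the relative change of $x$, and exponential
inequalities turn this into a bound on $y^p/x^p$. -/
lemma rpow_sub_abs_le_of_abs_sub_le {x y C c p : ℝ} (hp : 0 < p) (hc : 0 < c) (hC : 0 < C)
    (hx : c ≤ x) (hy : c ≤ y) (h : |y - x| ≤ C * x ^ (1 - p)) :
    |y ^ p - x ^ p| ≤ 2 * p * C * Real.exp (p * C / c ^ p) + 2 * p * C + (2 * C) := by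
  have hx0 : 0 < x := hc.trans_le hx
  have hy0 : 0 < y := hc.trans_le hy
  have hxp : 0 < x ^ p := Real.rpow_pos_of_pos hx0 p
  have hyp : 0 < y ^ p := Real.rpow_pos_of_pos hy0 p
  have hcp : 0 < c ^ p := Real.rpow_pos_of_pos hc p
  have hcx : c ^ p ≤ x ^ p := Real.rpow_le_rpow hc.le hx hp.le
  set u := C / x ^ p with hu
  have hu0 : 0 < u := by positivity
  have hux : u * x ^ p = C := by rw [hu]; field_simp
  have hdiv : C * x ^ (1 - p) = x * u := by
    rw [Real.rpow_sub hx0, Real.rpow_one, hu]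
    ring
  rw [hdiv, abs_le] at h
  have hexp := Real.exp_pos (p * C / c ^ p)
  have hexpm : 0 < 2 * p * C * Real.exp (p * C / c ^ p) := by positivity
  have hpC : 0 < 2 * p * C := by positivity
  rw [abs_le]
  constructor
  -- For $u\le 1/2$ one has $1-u\ge e^{-2u}$. Otherwise $x^p<2C$, and positivity of $y^p$ suffices;
  -- this is the source of the summand $2C$.
  · rcases le_or_gt u (1 / 2) with hu2 | hu2
    · have h1 : x * Real.exp (-(2 * u)) ≤ y := by
        have h3 : Real.exp (-(2 * u)) ≤ 1 - u := by
          rw [Real.exp_neg]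
          rw [inv_le_comm₀ (Real.exp_pos _) (by linarith)]
          have := Real.add_one_le_exp (2 * u)
          refine le_trans ?_ this
          rw [inv_le_iff_one_le_mul₀ (by linarith)]
          nlinarith
        nlinarith
      have h2 : x ^ p * Real.exp (-(2 * u) * p) ≤ y ^ p := by
        rw [Real.exp_mul, ← Real.mul_rpow hx0.le (Real.exp_pos _).le]
        exact Real.rpow_le_rpow (by positivity) h1 hp.le
      have h3 := Real.add_one_le_exp (-(2 * u) * p)
      have h4 : x ^ p * (-(2 * u) * p + 1) ≤ y ^ p :=
        (mul_le_mul_of_nonneg_left h3 hxp.le).trans h2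
      have h5 : x ^ p * (-(2 * u) * p + 1) = x ^ p - 2 * p * (u * x ^ p) := by ring
      rw [h5, hux] at h4
      linarith
    · have : x ^ p ≤ 2 * C := by nlinarith
      linarith
  · have h1 : y ≤ x * Real.exp u := by
      have := Real.add_one_le_exp u
      nlinarith
    have h2 : y ^ p ≤ x ^ p * Real.exp (u * p) := by
      rw [Real.exp_mul, ← Real.mul_rpow hx0.le (Real.exp_pos _).le]
      exact Real.rpow_le_rpow hy0.le h1 hp.le
    have h3 : Real.exp (u * p) ≤ 1 + u * p * Real.exp (u * p) := by
      have h := Real.add_one_le_exp (-(u * p))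
      have h6 : Real.exp (-(u * p)) * Real.exp (u * p) = 1 := by
        rw [← Real.exp_add]; simp
      nlinarith [Real.exp_pos (u * p)]
    have h4 : Real.exp (u * p) ≤ Real.exp (p * C / c ^ p) := by
      apply Real.exp_le_exp.2
      rw [hu, div_mul_eq_mul_div, mul_comm C p]
      gcongr
    have h5 : x ^ p * Real.exp (u * p) ≤ x ^ p + p * C * Real.exp (p * C / c ^ p) := by
      calc x ^ p * Real.exp (u * p) ≤ x ^ p * (1 + u * p * Real.exp (u * p)) := by gcongr
        _ = x ^ p + p * (u * x ^ p) * Real.exp (u * p) := by ring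
        _ = x ^ p + p * C * Real.exp (u * p) := by rw [hux]
        _ ≤ _ := by gcongr
    have h6 : 0 < p * C * Real.exp (p * C / c ^ p) := by positivity
    linarith

lemma IsWeight.exists_lower_bound {n : ℕ} {μ : ℝ} {Λ : (Fin n → ℤ) → ℝ} (h : IsWeight μ Λ) :
    ∃ c : ℝ, 0 < c ∧ ∀ k, c ≤ Λ k := by
  obtain ⟨μ₀, μ₁, C₀, C₁, h0, h01, h1, hC₀, hC₁, hb⟩ := h.growth
  refine ⟨C₀, hC₀, fun k => le_trans ?_ (hb k).1⟩
  have : 1 ≤ (1 + znorm k) ^ μ₀ := Real.one_le_rpow (by linarith [znorm_nonneg k]) h0.le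
  nlinarith

lemma IsWeight.pos {n : ℕ} {μ : ℝ} {Λ : (Fin n → ℤ) → ℝ} (h : IsWeight μ Λ) (k : Fin n → ℤ) :
    0 < Λ k := by
  obtain ⟨c, hc, hk⟩ := h.exists_lower_bound
  exact hc.trans_le (hk k)

lemma diffMulti_zero {n : ℕ} {E : Type*} [AddCommGroup E] (f : (Fin n → ℤ) → E) :
    diffMulti 0 f = f := by
  unfold diffMulti
  induction List.finRange n with
  | nil => rfl
  | cons a l ih => exact ih

lemma diffMulti_single {n : ℕ} {E : Type*} [AddCommGroup E] (i : Fin n) (f : (Fin n → ℤ) → E) :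
    diffMulti (Pi.single i 1) f = diff i f := by
  unfold diffMulti
  have key : ∀ l : List (Fin n), l.Nodup →
      l.foldr (fun j g => (diff j)^[(Pi.single i 1 : Fin n → ℕ) j] g) f =
        if i ∈ l then diff i f else f := by
    intro l
    induction l with
    | nil => simp
    | cons a l ih =>
      intro hl
      obtain ⟨ha, hl⟩ := List.nodup_cons.1 hl
      rw [List.foldr_cons, ih hl]
      by_cases h : i = a
      · subst h
        simp [ha]
      · simp [h]
  rw [key _ (List.nodup_finRange n)]
  simp

/-- The first-order estimate $|\Delta_i\Lambda|\le C\Lambda^{1-1/\mu}$ says that $\Lambda^{1/\mu}$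
is Lipschitz on unit steps. As $\Lambda^{1/\mu}$ is bounded below, the additive growth bound becomes
multiplicative, and raising to the power $\mu$ returns to $\Lambda$. -/
lemma IsWeight.moderate {n : ℕ} {μ : ℝ} {Λ : (Fin n → ℤ) → ℝ} (h : IsWeight μ Λ) :
    Moderate Λ := by
  have hμ : 0 < μ := by
    obtain ⟨μ₀, μ₁, C₀, C₁, h0, h01, h1, -⟩ := h.growth
    linarith
  obtain ⟨c, hc, hcΛ⟩ := h.exists_lower_bound
  have hstep : ∃ A : ℝ, 0 < A ∧ ∀ i k,
      |Λ (k + Pi.single i 1) ^ (1 / μ) - Λ k ^ (1 / μ)| ≤ A := by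
    have hi : ∀ i : Fin n, ∃ A : ℝ, 0 < A ∧ ∀ k,
        |Λ (k + Pi.single i 1) ^ (1 / μ) - Λ k ^ (1 / μ)| ≤ A := by
      intro i
      obtain ⟨C, hC, hb⟩ := h.diff_bound (Pi.single i 1) 0 (by simp)
      refine ⟨_, ?_, fun k => rpow_sub_abs_le_of_abs_sub_le (one_div_pos.2 hμ) hc hC (hcΛ _)
        (hcΛ _) ?_⟩
      · positivity
      · have := hb k
        rw [add_zero, diffMulti_single] at this
        simpa [zpowMulti, diff, mlen] using this
    choose A hA hb using hi
    refine ⟨1 + ∑ i, A i, ?_, fun i k => (hb i k).trans ?_⟩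
    · have := Finset.sum_nonneg fun i (_ : i ∈ Finset.univ) => (hA i).le
      linarith
    · have := Finset.single_le_sum (fun i _ => (hA i).le) (Finset.mem_univ i)
      linarith
  obtain ⟨A, hA, hstep⟩ := hstep
  have hmod : Moderate fun k => Λ k ^ (1 / μ) := by
    have hcp : 0 < c ^ (1 / μ) := Real.rpow_pos_of_pos hc _
    refine ⟨fun k => Real.rpow_nonneg (h.pos k).le _, 1 + A / c ^ (1 / μ), by positivity, 1,
      fun k v => ?_⟩
    have h1 := le_add_mul_sum_abs_of_unit_steps (F := fun k => Λ k ^ (1 / μ)) hstep k v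
    have h2 : c ^ (1 / μ) ≤ Λ k ^ (1 / μ) :=
      Real.rpow_le_rpow hc.le (hcΛ k) (one_div_pos.2 hμ).le
    refine h1.trans ?_
    have hS : ∑ i, |(v i : ℝ)| ≤ bracket v := by simp [bracket]
    have hb := one_le_bracket v
    have h3 : A * ∑ i, |(v i : ℝ)| ≤ A / c ^ (1 / μ) * bracket v * Λ k ^ (1 / μ) := by
      calc A * ∑ i, |(v i : ℝ)| ≤ A * bracket v := by gcongr
        _ = A / c ^ (1 / μ) * bracket v * c ^ (1 / μ) := by field_simp
        _ ≤ _ := by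
          have : 0 < bracket v := by linarith
          gcongr
    have h4 : Λ k ^ (1 / μ) ≤ bracket v * Λ k ^ (1 / μ) :=
      le_mul_of_one_le_left (hcp.le.trans h2) hb
    rw [pow_one]
    linarith
  have := hmod.rpow (fun k => Real.rpow_pos_of_pos (h.pos k) _) μ
  refine cast ?_ this
  congr 1
  ext k
  rw [← Real.rpow_mul (h.pos k).le, one_div_mul_cancel hμ.ne', Real.rpow_one]

lemma IsWeight.rpow_le_rpow {n : ℕ} {μ : ℝ} {Λ : (Fin n → ℤ) → ℝ} (h : IsWeight μ Λ) {s t : ℝ}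
    (hst : s ≤ t) : ∃ C : ℝ, 0 < C ∧ ∀ k, Λ k ^ s ≤ C * Λ k ^ t := by
  obtain ⟨c, hc, hcΛ⟩ := h.exists_lower_bound
  refine ⟨c ^ (s - t), Real.rpow_pos_of_pos hc _, fun k => ?_⟩
  have h1 : Λ k ^ s = Λ k ^ (s - t) * Λ k ^ t := by
    rw [← Real.rpow_add (h.pos k)]; simp
  rw [h1]
  exact mul_le_mul_of_nonneg_right (Real.rpow_le_rpow_of_nonpos hc (hcΛ k) (by linarith))
    (Real.rpow_nonneg (h.pos k).le _)

/-! ### Rapidly decaying kernels -/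

/-- `b(k, j)` is `O(ω(k))` with rapid decay in `j`. -/
def DecayBound {n : ℕ} (ω : (Fin n → ℤ) → ℝ) (b : (Fin n → ℤ) → (Fin n → ℤ) → ℂ) : Prop :=
  ∀ L : ℕ, ∃ C : ℝ, 0 < C ∧ ∀ k j, bracket j ^ L * ‖b k j‖ ≤ C * ω k

namespace DecayBound

variable {n : ℕ} {ω ω' : (Fin n → ℤ) → ℝ} {b b' : (Fin n → ℤ) → (Fin n → ℤ) → ℂ}

lemma add (h : DecayBound ω b) (h' : DecayBound ω b') :
    DecayBound ω fun k j => b k j + b' k j := by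
  intro L
  obtain ⟨C, hC, h⟩ := h L
  obtain ⟨C', hC', h'⟩ := h' L
  refine ⟨C + C', by positivity, fun k j => ?_⟩
  have hb := pow_pos (bracket_pos j) L
  calc bracket j ^ L * ‖b k j + b' k j‖ ≤ bracket j ^ L * (‖b k j‖ + ‖b' k j‖) := by
        gcongr; exact norm_add_le _ _
    _ ≤ _ := by linarith [h k j, h' k j]

lemma zero (hω : ∀ k, 0 ≤ ω k) : DecayBound ω fun _ _ => 0 :=
  fun _ => ⟨1, one_pos, fun k _ => by simpa using hω k⟩

lemma mul_left {c : (Fin n → ℤ) → ℂ} (h : DecayBound ω b) {A : ℝ} (q : ℕ)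
    (hc : ∀ j, ‖c j‖ ≤ A * bracket j ^ q) : DecayBound ω fun k j => c j * b k j := by
  intro L
  have hA : 0 ≤ A := by
    have h1 := (norm_nonneg _).trans (hc 0)
    exact nonneg_of_mul_nonneg_left h1 (pow_pos (bracket_pos _) _)
  obtain ⟨C, hC, h⟩ := h (q + L)
  refine ⟨(A + 1) * C, by positivity, fun k j => ?_⟩
  have hb := bracket_pos j
  calc bracket j ^ L * ‖c j * b k j‖ = bracket j ^ L * (‖c j‖ * ‖b k j‖) := by rw [norm_mul]
    _ ≤ bracket j ^ L * (((A + 1) * bracket j ^ q) * ‖b k j‖) := by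
        gcongr
        refine (hc j).trans ?_
        gcongr
        linarith
    _ = (A + 1) * (bracket j ^ (q + L) * ‖b k j‖) := by ring
    _ ≤ (A + 1) * (C * ω k) := mul_le_mul_of_nonneg_left (h k j) (by linarith)
    _ = _ := by ring

lemma neg (h : DecayBound ω b) : DecayBound ω fun k j => -b k j := by
  intro L
  simpa using h L

lemma sub (h : DecayBound ω b) (h' : DecayBound ω b') :
    DecayBound ω fun k j => b k j - b' k j := by
  simpa [sub_eq_add_neg] using h.add h'.neg

lemma mono (h : DecayBound ω b) {A : ℝ} (hA : 0 < A) (hω : ∀ k, ω k ≤ A * ω' k) :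
    DecayBound ω' b := by
  intro L
  obtain ⟨C, hC, h⟩ := h L
  refine ⟨C * A, by positivity, fun k j => (h k j).trans ?_⟩
  rw [mul_assoc]
  gcongr
  exact hω k

/-- If `b` is bounded at `(k, j)` by a polynomial in `j` times values of a decaying kernel at points
`k + v` with `|v| ≤ |j|`, then `b` decays. -/
lemma of_near (hω : Moderate ω) (h : DecayBound ω b) (q : ℕ)
    (hb : ∀ k j, ∀ M : ℝ, (∀ v, bracket v ≤ bracket j → ‖b (k + v) j‖ ≤ M) →
      ‖b' k j‖ ≤ bracket j ^ q * M) : DecayBound ω b' := by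
  obtain ⟨h0, A, hA, p, hω⟩ := hω
  intro L
  obtain ⟨C, hC, h⟩ := h (L + q + p)
  refine ⟨C * A, by positivity, fun k j => ?_⟩
  have hj := bracket_pos j
  -- Of the $L+q+p$ powers of decay available, $p$ pay for moving the weight from $k+v$ back to $k$
  -- and $q$ for the polynomial factor in the hypothesis.
  have h1 := hb k j (C * A * ω k / bracket j ^ (L + q)) fun v hv => by
    rw [le_div_iff₀ (by positivity)]
    have h2 := h (k + v) j
    have h3 : ω (k + v) ≤ A * bracket j ^ p * ω k := by
      refine (hω k v).trans ?_
      have := h0 k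
      have := (bracket_pos v).le
      gcongr
    have h4 : bracket j ^ p * (‖b (k + v) j‖ * bracket j ^ (L + q)) ≤
        bracket j ^ p * (C * A * ω k) := by
      calc _ = bracket j ^ (L + q + p) * ‖b (k + v) j‖ := by ring
        _ ≤ C * ω (k + v) := h2
        _ ≤ C * (A * bracket j ^ p * ω k) := by gcongr
        _ = _ := by ring
    exact le_of_mul_le_mul_left h4 (by positivity)
  calc bracket j ^ L * ‖b' k j‖
      ≤ bracket j ^ L * (bracket j ^ q * (C * A * ω k / bracket j ^ (L + q))) := by gcongr
    _ = C * A * ω k := by field_simp; ring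

lemma shift (hω : Moderate ω) (h : DecayBound ω b) (v : Fin n → ℤ) :
    DecayBound ω fun k j => b (k + v) j := by
  obtain ⟨h0, A, hA, p, hω⟩ := hω
  intro L
  obtain ⟨C, hC, h⟩ := h L
  have hv := bracket_pos v
  refine ⟨C * (A * bracket v ^ p), by positivity, fun k j => (h (k + v) j).trans ?_⟩
  rw [mul_assoc C]
  gcongr
  exact hω k v

lemma reflect (h : DecayBound ω b) : DecayBound ω fun k j => b k (-j) := by
  intro L
  obtain ⟨C, hC, h⟩ := h L
  exact ⟨C, hC, fun k j => by simpa [bracket_neg] using h k (-j)⟩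

end DecayBound

/-! ### The group algebra of `ℤⁿ` acting by shifts -/

/-- The group algebra of `ℤⁿ` acts on lattice functions by shifts. -/
def shiftAlg {n : ℕ} : AddMonoidAlgebra ℂ (Fin n → ℤ) →ₐ[ℂ] Module.End ℂ ((Fin n → ℤ) → ℂ) :=
  AddMonoidAlgebra.lift ℂ _ _
    { toFun := fun v => LinearMap.funLeft ℂ ℂ fun k => k + v.toAdd
      map_one' := by ext; simp [LinearMap.funLeft_apply]
      map_mul' := fun v w => by
        ext f k
        simp [LinearMap.funLeft_apply, add_assoc] }

lemma shiftAlg_single {n : ℕ} (v : Fin n → ℤ) (c : ℂ) (g : (Fin n → ℤ) → ℂ) (k : Fin n → ℤ) :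
    shiftAlg (AddMonoidAlgebra.single v c) g k = c * g (k + v) := by
  simp [shiftAlg, LinearMap.funLeft_apply]

lemma shiftAlg_mul {n : ℕ} (p q : AddMonoidAlgebra ℂ (Fin n → ℤ)) (g : (Fin n → ℤ) → ℂ) :
    shiftAlg (p * q) g = shiftAlg p (shiftAlg q g) := by
  simp

/-- Commutativity of the group algebra is what lets differences, shifts and Newton remainders be
interchanged freely. -/
lemma shiftAlg_comm {n : ℕ} (p q : AddMonoidAlgebra ℂ (Fin n → ℤ)) (g : (Fin n → ℤ) → ℂ) :
    shiftAlg p (shiftAlg q g) = shiftAlg q (shiftAlg p g) := by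
  rw [← shiftAlg_mul, mul_comm, shiftAlg_mul]

/-- The element of the group algebra acting as the forward difference. -/
def diffElt {n : ℕ} (i : Fin n) : AddMonoidAlgebra ℂ (Fin n → ℤ) :=
  AddMonoidAlgebra.single (Pi.single i 1) 1 - 1

/-- The element of the group algebra acting as `Δ^α`. -/
def diffMultiElt {n : ℕ} (α : Fin n → ℕ) : AddMonoidAlgebra ℂ (Fin n → ℤ) := ∏ i, diffElt i ^ α i

lemma shiftAlg_diffElt {n : ℕ} (i : Fin n) (g : (Fin n → ℤ) → ℂ) :
    shiftAlg (diffElt i) g = diff i g := by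
  ext k
  simp [diffElt, diff, shiftAlg_single]

lemma shiftAlg_diffElt_pow {n : ℕ} (i : Fin n) (r : ℕ) (g : (Fin n → ℤ) → ℂ) :
    shiftAlg (diffElt i ^ r) g = (diff i)^[r] g := by
  induction r with
  | zero => simp
  | succ r ih => rw [pow_succ', shiftAlg_mul, ih, shiftAlg_diffElt, Function.iterate_succ_apply']

lemma diffMulti_eq_shiftAlg {n : ℕ} (α : Fin n → ℕ) (g : (Fin n → ℤ) → ℂ) :
    diffMulti α g = shiftAlg (diffMultiElt α) g := by
  unfold diffMulti diffMultiElt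
  rw [Fin.prod_univ_def]
  induction List.finRange n with
  | nil => simp
  | cons a l ih => rw [List.foldr_cons, ih, List.map_cons, List.prod_cons, shiftAlg_mul,
      shiftAlg_diffElt_pow]

lemma diffMultiElt_add {n : ℕ} (α β : Fin n → ℕ) :
    diffMultiElt (α + β) = diffMultiElt α * diffMultiElt β := by
  simp [diffMultiElt, pow_add, Finset.prod_mul_distrib]

lemma diffMulti_add {n : ℕ} (α β : Fin n → ℕ) (g : (Fin n → ℤ) → ℂ) :
    diffMulti (α + β) g = diffMulti α (diffMulti β g) := by
  simp only [diffMulti_eq_shiftAlg, diffMultiElt_add, shiftAlg_mul]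

lemma diffMultiElt_single {n : ℕ} (i : Fin n) (r : ℕ) :
    diffMultiElt (Pi.single i r) = diffElt i ^ r := by
  unfold diffMultiElt
  rw [Finset.prod_eq_single i]
  · simp
  · intro j _ hj
    simp [hj]
  · simp

lemma mlen_add {n : ℕ} (α β : Fin n → ℕ) : mlen (α + β) = mlen α + mlen β := by
  simp [mlen, Finset.sum_add_distrib]

lemma mlen_single {n : ℕ} (i : Fin n) (r : ℕ) : mlen (Pi.single i r) = r := by
  simp [mlen]

/-! ### Falling factorials and the Newton expansion in one variable -/

/-- The falling factorial `s (s - 1) ⋯ (s - r + 1)` of an integer. -/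
def fallFact (s : ℤ) (r : ℕ) : ℂ := ∏ t ∈ Finset.range r, ((s : ℂ) - t)

lemma fallFact_zero (s : ℤ) : fallFact s 0 = 1 := by simp [fallFact]

lemma fallFact_succ (s : ℤ) (r : ℕ) : fallFact s (r + 1) = fallFact s r * (s - r) := by
  simp [fallFact, Finset.prod_range_succ]

lemma fallFact_zero_succ (r : ℕ) : fallFact 0 (r + 1) = 0 := by
  simp [fallFact, Finset.prod_range_succ']

/-- The discrete counterpart of $(s^{r+1})'=(r+1)s^r$. -/
lemma fallFact_add_one_sub (s : ℤ) (r : ℕ) :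
    fallFact (s + 1) (r + 1) - fallFact s (r + 1) = (r + 1) * fallFact s r := by
  have h : fallFact (s + 1) (r + 1) = (s + 1) * fallFact s r := by
    simp [fallFact, Finset.prod_range_succ', mul_comm]
  rw [h, fallFact_succ]
  ring

lemma norm_fallFact_le (s : ℤ) (r : ℕ) : ‖fallFact s r‖ ≤ (1 + r : ℝ) ^ r * (1 + |(s : ℝ)|) ^ r := by
  rw [fallFact, norm_prod, ← mul_pow, ← Finset.card_range r, ← Finset.prod_const]
  rw [Finset.card_range]
  refine Finset.prod_le_prod (fun _ _ => norm_nonneg _) fun t ht => ?_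
  have ht : (t : ℝ) ≤ r := by exact_mod_cast (Finset.mem_range.1 ht).le
  have h1 : ‖(s : ℂ) - t‖ ≤ |(s : ℝ)| + t := by
    refine (norm_sub_le _ _).trans (le_of_eq ?_)
    rw [Complex.norm_natCast, ← Complex.ofReal_intCast, Complex.norm_real, Real.norm_eq_abs]
  have h2 := abs_nonneg (s : ℝ)
  have h3 : (0 : ℝ) ≤ t := by positivity
  nlinarith

lemma norm_le_of_steps {F : ℤ → ℂ} {B : ℝ} (h0 : F 0 = 0) (s : ℤ)
    (h : ∀ t, |t| ≤ |s| → ‖F (t + 1) - F t‖ ≤ B) : ‖F s‖ ≤ |(s : ℝ)| * B := by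
  have key : ∀ (F : ℤ → ℂ), F 0 = 0 → ∀ m : ℕ,
      (∀ t : ℕ, t < m → ‖F (t + 1) - F t‖ ≤ B) → ‖F m‖ ≤ m * B := by
    intro F h0 m
    induction m with
    | zero => simp [h0]
    | succ m ih =>
      intro h
      have h1 := ih fun t ht => h t (by omega)
      have h2 := h m (by omega)
      have h3 : F ((m + 1 : ℕ) : ℤ) = (F (m + 1) - F m) + F m := by push_cast; ring
      rw [h3]
      refine (norm_add_le _ _).trans ?_
      push_cast
      linarith
  obtain ⟨m, rfl | rfl⟩ := s.eq_nat_or_neg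
  · have := key F h0 m fun t ht => h t (by simp; omega)
    simpa using this
  · have := key (fun t => F (-t)) (by simpa using h0) m fun t ht => by
      have := h (-(t + 1)) (by
        rw [abs_neg, abs_neg, abs_of_nonneg (by positivity), abs_of_nonneg (by positivity)]
        omega)
      rw [norm_sub_rev]
      simpa using this
    simpa using this

/-- The remainder of order $N+1$ vanishes at $0$, and its forward difference is the remainder of
order $N$ for $\Delta g$. Summing the inductive bound over the $|s|$ steps from $0$ to $s$ gains one
factor $|s|$. -/
lemma newton_remainder_bound (N : ℕ) (g : ℤ → ℂ) (s : ℤ) (M : ℝ)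
    (h : ∀ t, |t| ≤ |s| → ‖(fwdDiff 1)^[N] g t‖ ≤ M) :
    ‖g s - ∑ r ∈ Finset.range N, fallFact s r / (r.factorial : ℂ) * (fwdDiff 1)^[r] g 0‖ ≤
      |(s : ℝ)| ^ N * M := by
  induction N generalizing g s M with
  | zero => simpa using h s le_rfl
  | succ N ih =>
    set F : ℤ → ℂ := fun s => g s - ∑ r ∈ Finset.range (N + 1),
      fallFact s r / (r.factorial : ℂ) * (fwdDiff 1)^[r] g 0 with hF
    have h0 : F 0 = 0 := by
      simp [hF, Finset.sum_range_succ', fallFact_zero_succ, fallFact_zero]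
    have hstep : ∀ t, F (t + 1) - F t = fwdDiff 1 g t - ∑ r ∈ Finset.range N,
        fallFact t r / (r.factorial : ℂ) * (fwdDiff 1)^[r] (fwdDiff 1 g) 0 := by
      intro t
      have e : ∀ r, fallFact t r / (r.factorial : ℂ) * (fwdDiff 1)^[r] (fwdDiff 1 g) 0 =
          fallFact (t + 1) (r + 1) / ((r + 1).factorial : ℂ) * (fwdDiff 1)^[r + 1] g 0
          - fallFact t (r + 1) / ((r + 1).factorial : ℂ) * (fwdDiff 1)^[r + 1] g 0 := by
        intro r
        rw [← sub_mul, ← sub_div, fallFact_add_one_sub, Nat.factorial_succ,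
          Function.iterate_succ_apply]
        have h1 : (r.factorial : ℂ) ≠ 0 := by exact_mod_cast r.factorial_ne_zero
        have h2 : ((r : ℂ) + 1) ≠ 0 := by exact_mod_cast r.succ_ne_zero
        push_cast
        field_simp
      simp only [e, hF, Finset.sum_sub_distrib, Finset.sum_range_succ', fallFact_zero, fwdDiff]
      simp
      ring
    have := norm_le_of_steps (F := F) (B := |(s : ℝ)| ^ N * M) h0 s fun t ht => by
      rw [hstep]
      refine (ih (fwdDiff 1 g) t M fun u hu => ?_).trans ?_
      · exact h u (hu.trans ht)
      · have hM : 0 ≤ M := (norm_nonneg _).trans (h s le_rfl)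
        have : |(t : ℝ)| ≤ |(s : ℝ)| := by exact_mod_cast ht
        gcongr
    refine this.trans (le_of_eq ?_)
    ring

/-! ### Kernel classes -/

/-- The weight `Λ^s / ∏ (1 + |kᵢ|)^{γᵢ}`. -/
def symWeight {n : ℕ} (Λ : (Fin n → ℤ) → ℝ) (s : ℝ) (γ : Fin n → ℕ) (k : Fin n → ℤ) : ℝ :=
  Λ k ^ s * (∏ i, (1 + |(k i : ℝ)|) ^ γ i)⁻¹

lemma moderate_symWeight {n : ℕ} {μ : ℝ} {Λ : (Fin n → ℤ) → ℝ} (h : IsWeight μ Λ) (s : ℝ)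
    (γ : Fin n → ℕ) : Moderate (symWeight Λ s γ) := by
  refine (h.moderate.rpow h.pos s).mul (Moderate.inv (Moderate.prod _ fun i _ =>
    (moderate_one_add_abs i).pow (γ i)) fun k => ?_)
  exact Finset.prod_pos fun i _ => by positivity

/-- Kernels whose differences obey the estimates of Fourier coefficients of a symbol in
`M^m_{ρ,Λ}`. -/
def KernelClass {n : ℕ} (Λ : (Fin n → ℤ) → ℝ) (ρ m : ℝ) (a : (Fin n → ℤ) → (Fin n → ℤ) → ℂ) :
    Prop :=
  ∀ α γ : Fin n → ℕ, (∀ i, γ i ≤ 1) →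
    DecayBound (symWeight Λ (m - ρ * (mlen α : ℝ)) γ) fun k j =>
      diffMulti (α + γ) (fun l => a l j) k

/-- `p` maps kernels of order `m` to kernels of order `m - ρ N`. -/
def OpOrder {n : ℕ} (Λ : (Fin n → ℤ) → ℝ) (ρ : ℝ) (N : ℕ)
    (p : (Fin n → ℤ) → AddMonoidAlgebra ℂ (Fin n → ℤ)) : Prop :=
  ∀ m a, KernelClass Λ ρ m a →
    KernelClass Λ ρ (m - ρ * (N : ℝ)) fun k j => shiftAlg (p j) (fun l => a l j) k

section OpOrder

variable {n : ℕ} {Λ : (Fin n → ℤ) → ℝ} {ρ μ : ℝ} {N M : ℕ}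
  {p q : (Fin n → ℤ) → AddMonoidAlgebra ℂ (Fin n → ℤ)}

lemma KernelClass.add {m : ℝ} {a b : (Fin n → ℤ) → (Fin n → ℤ) → ℂ}
    (ha : KernelClass Λ ρ m a) (hb : KernelClass Λ ρ m b) :
    KernelClass Λ ρ m fun k j => a k j + b k j := by
  intro α γ hγ
  convert (ha α γ hγ).add (hb α γ hγ) using 1
  ext k j
  have e : (fun l => a l j + b l j) = (fun l => a l j) + fun l => b l j := rfl
  rw [e]
  simp only [diffMulti_eq_shiftAlg, map_add, Pi.add_apply]

lemma KernelClass.zero (hΛ : IsWeight μ Λ) (m : ℝ) : KernelClass Λ ρ m fun _ _ => 0 := by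
  intro α γ hγ
  convert DecayBound.zero (moderate_symWeight hΛ _ γ).1 using 1
  ext k j
  have e : (fun _ : Fin n → ℤ => (0 : ℂ)) = 0 := rfl
  rw [e, diffMulti_eq_shiftAlg, map_zero]
  rfl

lemma KernelClass.mul_left {m : ℝ} {a : (Fin n → ℤ) → (Fin n → ℤ) → ℂ} (ha : KernelClass Λ ρ m a)
    {c : (Fin n → ℤ) → ℂ} {A : ℝ} (q : ℕ) (hc : ∀ j, ‖c j‖ ≤ A * bracket j ^ q) :
    KernelClass Λ ρ m fun k j => c j * a k j := by
  intro α γ hγ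
  convert (ha α γ hγ).mul_left q hc using 1
  ext k j
  have e : (fun l => c j * a l j) = c j • fun l => a l j := rfl
  rw [e]
  simp only [diffMulti_eq_shiftAlg, map_smul, Pi.smul_apply, smul_eq_mul]

lemma KernelClass.mono (hΛ : IsWeight μ Λ) {m m' : ℝ} (hm : m ≤ m')
    {a : (Fin n → ℤ) → (Fin n → ℤ) → ℂ} (ha : KernelClass Λ ρ m a) : KernelClass Λ ρ m' a := by
  intro α γ hγ
  obtain ⟨C, hC, h⟩ := hΛ.rpow_le_rpow
    (show m - ρ * (mlen α : ℝ) ≤ m' - ρ * (mlen α : ℝ) by linarith)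
  refine (ha α γ hγ).mono hC fun k => ?_
  unfold symWeight
  rw [← mul_assoc]
  gcongr
  exact h k

/-! ### Calculus of orders for shift operators with coefficients depending on $j$ -/

lemma OpOrder.add (hp : OpOrder Λ ρ N p) (hq : OpOrder Λ ρ N q) :
    OpOrder Λ ρ N fun j => p j + q j := by
  intro m a ha
  convert (hp m a ha).add (hq m a ha) using 1
  ext k j
  simp

lemma OpOrder.zero (hΛ : IsWeight μ Λ) : OpOrder Λ ρ N fun _ => 0 := by
  intro m a ha
  convert KernelClass.zero hΛ _ using 1
  ext k j
  simp

lemma OpOrder.sum (hΛ : IsWeight μ Λ) {ι : Type*} (s : Finset ι)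
    {p : ι → (Fin n → ℤ) → AddMonoidAlgebra ℂ (Fin n → ℤ)} (h : ∀ x ∈ s, OpOrder Λ ρ N (p x)) :
    OpOrder Λ ρ N fun j => ∑ x ∈ s, p x j := by
  classical
  induction s using Finset.induction_on with
  | empty => simpa using OpOrder.zero hΛ
  | insert x s hx ih =>
    simp only [Finset.sum_insert hx]
    exact (h x (by simp)).add (ih fun y hy => h y (by simp [hy]))

lemma OpOrder.mul (hp : OpOrder Λ ρ N p) (hq : OpOrder Λ ρ M q) :
    OpOrder Λ ρ (N + M) fun j => p j * q j := by
  intro m a ha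
  have := hp _ _ (hq m a ha)
  simp only [shiftAlg_mul]
  convert this using 1
  push_cast
  ring

/-- Coefficients of polynomial growth in $j$ cost no order, because kernels decay rapidly in $j$. -/
lemma OpOrder.smul (hp : OpOrder Λ ρ N p) {c : (Fin n → ℤ) → ℂ} {A : ℝ} (r : ℕ)
    (hc : ∀ j, ‖c j‖ ≤ A * bracket j ^ r) : OpOrder Λ ρ N fun j => c j • p j := by
  intro m a ha
  convert (hp m a ha).mul_left r hc using 1
  ext k j
  simp

lemma OpOrder.mono (hΛ : IsWeight μ Λ) (hρ : 0 < ρ) (hNM : N ≤ M) (hp : OpOrder Λ ρ M p) :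
    OpOrder Λ ρ N p := by
  intro m a ha
  refine (hp m a ha).mono hΛ ?_
  have : (N : ℝ) ≤ M := by exact_mod_cast hNM
  gcongr

lemma OpOrder.one : OpOrder Λ ρ 0 fun _ => 1 := by
  intro m a ha
  simpa using ha

lemma OpOrder.prod {ι : Type*} (s : Finset ι)
    {p : ι → (Fin n → ℤ) → AddMonoidAlgebra ℂ (Fin n → ℤ)} {N : ι → ℕ}
    (h : ∀ x ∈ s, OpOrder Λ ρ (N x) (p x)) :
    OpOrder Λ ρ (∑ x ∈ s, N x) fun j => ∏ x ∈ s, p x j := by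
  classical
  induction s using Finset.induction_on with
  | empty => simpa using OpOrder.one
  | insert x s hx ih =>
    simp only [Finset.prod_insert hx, Finset.sum_insert hx]
    exact (h x (by simp)).mul (ih fun y hy => h y (by simp [hy]))

/-- Telescoping: $p\prod p_y-q\prod q_y=p(\prod p_y-\prod q_y)+(p-q)\prod q_y$, with every factor
other than the difference of order $0$. -/
lemma OpOrder.prod_sub_prod (hΛ : IsWeight μ Λ) {ι : Type*} (s : Finset ι)
    {p q : ι → (Fin n → ℤ) → AddMonoidAlgebra ℂ (Fin n → ℤ)}
    (hp : ∀ x ∈ s, OpOrder Λ ρ 0 (p x)) (hq : ∀ x ∈ s, OpOrder Λ ρ 0 (q x))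
    (h : ∀ x ∈ s, OpOrder Λ ρ N fun j => p x j - q x j) :
    OpOrder Λ ρ N fun j => ∏ x ∈ s, p x j - ∏ x ∈ s, q x j := by
  classical
  induction s using Finset.induction_on with
  | empty => simpa using OpOrder.zero hΛ
  | insert x s hx ih =>
    have ih := ih (fun y hy => hp y (by simp [hy])) (fun y hy => hq y (by simp [hy]))
      (fun y hy => h y (by simp [hy]))
    have h1 := (hp x (by simp)).mul ih
    have h2 := (h x (by simp)).mul (OpOrder.prod s fun y hy => hq y (by simp [hy]))
    simp only [zero_add] at h1
    simp only [Finset.sum_const_zero, add_zero] at h2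
    convert h1.add h2 using 2 with j
    rw [Finset.prod_insert hx, Finset.prod_insert hx]
    ring

/-! ### Newton expansion of the lattice shift -/

lemma opOrder_diffElt_pow (i : Fin n) (r : ℕ) : OpOrder Λ ρ r fun _ => diffElt i ^ r := by
  intro m a ha α γ hγ
  convert ha (Pi.single i r + α) γ hγ using 2 with k j
  · rw [mlen_add, mlen_single]
    push_cast
    ring
  · rw [add_assoc, add_comm (Pi.single i r : Fin n → ℕ)]
    simp only [diffMulti_eq_shiftAlg, diffMultiElt_add (α + γ), shiftAlg_mul, diffMultiElt_single]

lemma diff_iterate_line (i : Fin n) (g : (Fin n → ℤ) → ℂ) (k : Fin n → ℤ) (r : ℕ) (t : ℤ) :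
    (fwdDiff 1)^[r] (fun s : ℤ => g (k + Pi.single i s)) t =
      (diff i)^[r] g (k + Pi.single i t) := by
  induction r generalizing t with
  | zero => rfl
  | succ r ih =>
    rw [Function.iterate_succ_apply', Function.iterate_succ_apply', fwdDiff, ih, ih, diff,
      Pi.single_add, add_assoc]

/-- On the line through $k$ in direction $e_i$ this is the one-variable Newton remainder: it is
bounded by $|j_i|^N$ times values of $\Delta_i^N$ at points $k+te_i$ with $|t|\le|j_i|$, which is
the situation of `DecayBound.of_near`. -/
lemma opOrder_newton_remainder (hΛ : IsWeight μ Λ) (i : Fin n) (N : ℕ) :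
    OpOrder Λ ρ N fun j => AddMonoidAlgebra.single (Pi.single i (j i)) (1 : ℂ) -
      ∑ r ∈ Finset.range N, (fallFact (j i) r / (r.factorial : ℂ)) • diffElt i ^ r := by
  intro m a ha α γ hγ
  have h1 := opOrder_diffElt_pow (Λ := Λ) (ρ := ρ) i N m a ha α γ hγ
  refine h1.of_near (moderate_symWeight hΛ _ γ) N fun k j B hB => ?_
  simp only [diffMulti_eq_shiftAlg] at hB ⊢
  -- Commuting $\Delta^{\alpha+\gamma}$ inside lets the Newton bound act on the already differenced
  -- kernel.
  rw [shiftAlg_comm]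
  simp_rw [shiftAlg_comm (diffMultiElt (α + γ))] at hB
  set g := shiftAlg (diffMultiElt (α + γ)) fun l => a l j with hg
  have h2 := newton_remainder_bound N (fun s : ℤ => g (k + Pi.single i s)) (j i) B fun t ht => by
    rw [diff_iterate_line]
    have := hB (Pi.single i t) (by
      rw [bracket_single]
      refine le_trans ?_ (one_add_abs_le_bracket j i)
      have : |(t : ℝ)| ≤ |(j i : ℝ)| := by exact_mod_cast ht
      linarith)
    rwa [shiftAlg_diffElt_pow] at this
  have h3 : 0 ≤ B := (norm_nonneg _).trans (hB 0 (by simpa [bracket] using one_le_bracket j))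
  have h4 : shiftAlg (AddMonoidAlgebra.single (Pi.single i (j i)) (1 : ℂ) -
      ∑ r ∈ Finset.range N, (fallFact (j i) r / (r.factorial : ℂ)) • diffElt i ^ r) g k =
      g (k + Pi.single i (j i)) - ∑ r ∈ Finset.range N, fallFact (j i) r / (r.factorial : ℂ) *
        (fwdDiff 1)^[r] (fun s : ℤ => g (k + Pi.single i s)) 0 := by
    simp only [diff_iterate_line, ← shiftAlg_diffElt_pow]
    simp [shiftAlg_single]
  rw [h4]
  refine h2.trans ?_
  gcongr
  exact abs_le_bracket j i

lemma norm_fallFact_div_le (i : Fin n) (r : ℕ) (j : Fin n → ℤ) :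
    ‖fallFact (j i) r / (r.factorial : ℂ)‖ ≤ (1 + r : ℝ) ^ r * bracket j ^ r := by
  have hf : (1 : ℝ) ≤ r.factorial := by exact_mod_cast r.factorial_pos
  rw [norm_div, Complex.norm_natCast]
  refine (div_le_self (norm_nonneg _) hf).trans ((norm_fallFact_le _ _).trans ?_)
  have := one_add_abs_le_bracket j i
  gcongr

/-- The multi-index falling factorial `j^{(α)}`. -/
def fallMulti (j : Fin n → ℤ) (α : Fin n → ℕ) : ℂ := ∏ i, fallFact (j i) (α i)

lemma prod_newton_terms (j : Fin n → ℤ) (α : Fin n → ℕ) :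
    ∏ i, (fallFact (j i) (α i) / ((α i).factorial : ℂ)) • diffElt i ^ α i =
      ((mfact α : ℂ)⁻¹ * fallMulti j α) • diffMultiElt α := by
  rw [Finset.prod_smul, Finset.prod_div_distrib, fallMulti, mfact, diffMultiElt]
  push_cast
  rw [div_eq_inv_mul]

lemma opOrder_newton_term (α : Fin n → ℕ) : OpOrder Λ ρ (mlen α) fun j =>
    ((mfact α : ℂ)⁻¹ * fallMulti j α) • diffMultiElt α := by
  have := OpOrder.prod (Λ := Λ) (ρ := ρ) Finset.univ fun i _ =>
    (opOrder_diffElt_pow i (α i)).smul (α i) (norm_fallFact_div_le i (α i))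
  simp_rw [prod_newton_terms] at this
  exact this

/-- The multi-dimensional Newton expansion of the shift by `j`. -/
lemma opOrder_newton (hΛ : IsWeight μ Λ) (hρ : 0 < ρ) (N : ℕ) :
    OpOrder Λ ρ N fun j => AddMonoidAlgebra.single j (1 : ℂ) -
      ∑ α ∈ multiIdxLT n N, ((mfact α : ℂ)⁻¹ * fallMulti j α) • diffMultiElt α := by
  classical
  have hE : ∀ i : Fin n, OpOrder Λ ρ 0 fun j => ∑ r ∈ Finset.range N,
      (fallFact (j i) r / (r.factorial : ℂ)) • diffElt i ^ r := fun i =>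
    OpOrder.sum hΛ _ fun r _ => ((opOrder_diffElt_pow i r).smul r
      (norm_fallFact_div_le i r)).mono hΛ hρ (Nat.zero_le _)
  -- With $N=0$ the Newton sum is empty, so the remainder is the coordinate shift itself.
  have hT : ∀ i : Fin n, OpOrder Λ ρ 0 fun j =>
      AddMonoidAlgebra.single (Pi.single i (j i)) (1 : ℂ) := fun i => by
    simpa using opOrder_newton_remainder (ρ := ρ) hΛ i 0
  have h1 := OpOrder.prod_sub_prod hΛ Finset.univ (fun i _ => hT i) (fun i _ => hE i)
    fun i _ => opOrder_newton_remainder hΛ i N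
  -- The product of one-variable expansions runs over the box $\alpha_i<N$; its terms with
  -- $|\alpha|\ge N$ have order at least $N$ and join the remainder.
  have h2 : OpOrder Λ ρ N fun j => ∑ α ∈ (Fintype.piFinset fun _ : Fin n => Finset.range N).filter
      (fun α => ¬ mlen α < N), ((mfact α : ℂ)⁻¹ * fallMulti j α) • diffMultiElt α :=
    OpOrder.sum hΛ _ fun α hα => (opOrder_newton_term α).mono hΛ hρ
      (not_lt.1 (Finset.mem_filter.1 hα).2)
  convert h1.add h2 using 2 with j
  have e1 : ∏ i, AddMonoidAlgebra.single (Pi.single i (j i) : Fin n → ℤ) (1 : ℂ) =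
      AddMonoidAlgebra.single j 1 := by
    have : ∀ s : Finset (Fin n), ∏ i ∈ s, AddMonoidAlgebra.single (Pi.single i (j i) : Fin n → ℤ)
        (1 : ℂ) = AddMonoidAlgebra.single (∑ i ∈ s, Pi.single i (j i)) 1 := by
      intro s
      induction s using Finset.induction_on with
      | empty => rfl
      | insert x s hx ih =>
        rw [Finset.prod_insert hx, Finset.sum_insert hx, ih, AddMonoidAlgebra.single_mul_single,
          mul_one]
    rw [this, Finset.univ_sum_single]
  have e2 : ∏ i, ∑ r ∈ Finset.range N, (fallFact (j i) r / (r.factorial : ℂ)) • diffElt i ^ r =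
      ∑ α ∈ Fintype.piFinset fun _ : Fin n => Finset.range N,
        ((mfact α : ℂ)⁻¹ * fallMulti j α) • diffMultiElt α := by
    rw [Finset.prod_univ_sum]
    refine Finset.sum_congr rfl fun α _ => ?_
    rw [prod_newton_terms]
  rw [e1, e2, multiIdxLT, ← Finset.sum_filter_add_sum_filter_not
    (Fintype.piFinset fun _ : Fin n => Finset.range N) (fun α => mlen α < N)]
  abel

end OpOrder

open MeasureTheory

/-! ### Smooth functions on the torus -/

/-- The quotient map `ℝⁿ → 𝕋ⁿ`. -/
def toTorus {n : ℕ} (y : Fin n → ℝ) : UnitAddTorus (Fin n) := fun i => (y i : UnitAddCircle)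

lemma isOpenQuotientMap_toTorus (n : ℕ) : IsOpenQuotientMap (toTorus (n := n)) :=
  IsOpenQuotientMap.piMap (f := fun _ : Fin n => ((↑) : ℝ → UnitAddCircle)) fun _ =>
    QuotientAddGroup.isOpenQuotientMap_mk

lemma toTorus_add_single {n : ℕ} (y : Fin n → ℝ) (i : Fin n) (t : ℝ) :
    toTorus (y + t • Pi.single i 1) = toTorus y + Pi.single i (t : UnitAddCircle) := by
  ext j
  by_cases h : j = i
  · subst h
    simp [toTorus]
  · simp [toTorus, h]

instance haarTorus.isAddHaarMeasure (n : ℕ) : (haarTorus n).IsAddHaarMeasure := by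
  unfold haarTorus
  infer_instance

instance haarTorus.isProbabilityMeasure (n : ℕ) : IsProbabilityMeasure (haarTorus n) := by
  unfold haarTorus
  infer_instance

instance haarTorus.isNegInvariant (n : ℕ) : (haarTorus n).IsNegInvariant :=
  Measure.IsAddHaarMeasure.isNegInvariant_of_regular (haarTorus n)

variable {n : ℕ} {u v : UnitAddTorus (Fin n) → ℂ}

lemma smoothTorus_iff : SmoothTorus u ↔ ContDiff ℝ ((⊤ : ℕ∞) : WithTop ℕ∞) (u ∘ toTorus) := Iff.rfl

namespace SmoothTorus

lemma continuous (hu : SmoothTorus u) : Continuous u :=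
  (isOpenQuotientMap_toTorus n).isQuotientMap.continuous_iff.2 (smoothTorus_iff.1 hu).continuous

lemma exists_bound (hu : SmoothTorus u) : ∃ C, ∀ x, ‖u x‖ ≤ C := by
  obtain ⟨C, hC⟩ := isCompact_univ.exists_bound_of_continuousOn hu.continuous.continuousOn
  exact ⟨C, fun x => hC x (Set.mem_univ x)⟩

lemma const_mul (hu : SmoothTorus u) (c : ℂ) : SmoothTorus fun x => c * u x :=
  ContDiff.mul contDiff_const hu

lemma sub (hu : SmoothTorus u) (hv : SmoothTorus v) : SmoothTorus (u - v) :=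
  ContDiff.sub hu hv

lemma sum {ι : Type*} (s : Finset ι) {u : ι → UnitAddTorus (Fin n) → ℂ}
    (h : ∀ i ∈ s, SmoothTorus (u i)) : SmoothTorus fun x => ∑ i ∈ s, u i x :=
  ContDiff.sum h

lemma comp_neg (hu : SmoothTorus u) : SmoothTorus fun x => u (-x) := by
  have := (smoothTorus_iff.1 hu).comp (contDiff_neg (n := ((⊤ : ℕ∞) : WithTop ℕ∞)))
  exact this

lemma hasDerivAt (hu : SmoothTorus u) (i : Fin n) (y : Fin n → ℝ) :
    HasDerivAt (fun t : ℝ => u (toTorus y + Pi.single i (t : UnitAddCircle)))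
      (fderiv ℝ (u ∘ toTorus) y (Pi.single i 1)) 0 := by
  have h1 : HasFDerivAt (u ∘ toTorus) (fderiv ℝ (u ∘ toTorus) y) (y + (0 : ℝ) • Pi.single i 1) := by
    rw [zero_smul, add_zero]
    exact ((smoothTorus_iff.1 hu).differentiable (by simp) y).hasFDerivAt
  have h2 : HasDerivAt (fun t : ℝ => y + t • (Pi.single i 1 : Fin n → ℝ)) (Pi.single i 1) 0 := by
    simpa using ((hasDerivAt_id (0 : ℝ)).smul_const (Pi.single i 1 : Fin n → ℝ)).const_add y
  have h3 := h1.comp_hasDerivAt 0 h2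
  simpa only [Function.comp_def, toTorus_add_single] using h3

lemma torusD_toTorus (hu : SmoothTorus u) (i : Fin n) (y : Fin n → ℝ) :
    torusD i u (toTorus y) =
      (2 * (Real.pi : ℂ) * Complex.I)⁻¹ * fderiv ℝ (u ∘ toTorus) y (Pi.single i 1) := by
  rw [torusD, (hu.hasDerivAt i y).deriv]

lemma torusD (hu : SmoothTorus u) (i : Fin n) : SmoothTorus (torusD i u) := by
  have h1 : ContDiff ℝ ((⊤ : ℕ∞) : WithTop ℕ∞) fun y => fderiv ℝ (u ∘ toTorus) y (Pi.single i 1) :=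
    ((smoothTorus_iff.1 hu).fderiv_right (by simp)).clm_apply contDiff_const
  have h2 : LatticePDO.torusD i u ∘ toTorus = fun y =>
      (2 * (Real.pi : ℂ) * Complex.I)⁻¹ * fderiv ℝ (u ∘ toTorus) y (Pi.single i 1) :=
    funext fun y => hu.torusD_toTorus i y
  rw [smoothTorus_iff, h2]
  exact contDiff_const.mul h1

lemma hasDerivAt_translate (hu : SmoothTorus u) (i : Fin n) (x : UnitAddTorus (Fin n)) (t : ℝ) :
    HasDerivAt (fun t : ℝ => u (x + Pi.single i (t : UnitAddCircle)))
      (2 * (Real.pi : ℂ) * Complex.I *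
        LatticePDO.torusD i u (x + Pi.single i (t : UnitAddCircle))) t := by
  obtain ⟨y, hy⟩ := (isOpenQuotientMap_toTorus n).surjective (x + Pi.single i (t : UnitAddCircle))
  have h1 := hu.hasDerivAt i y
  rw [← sub_self t] at h1
  have h3 := h1.comp_sub_const t t
  have hpi : (2 * (Real.pi : ℂ) * Complex.I) ≠ 0 := by
    simp [Real.pi_ne_zero, Complex.I_ne_zero]
  rw [← hy, hu.torusD_toTorus, mul_inv_cancel_left₀ hpi]
  refine h3.congr_of_eventuallyEq (Filter.Eventually.of_forall fun s => ?_)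
  simp only
  rw [hy, add_assoc, ← Pi.single_add, AddCircle.coe_sub, add_sub_cancel]

end SmoothTorus

/-! ### Fourier coefficients on the torus -/

lemma mFourier_add_apply (j : Fin n → ℤ) (x y : UnitAddTorus (Fin n)) :
    UnitAddTorus.mFourier j (x + y) = UnitAddTorus.mFourier j x * UnitAddTorus.mFourier j y := by
  simp [UnitAddTorus.mFourier, ← Finset.prod_mul_distrib, fourier_apply, AddCircle.toCircle_add]

lemma mFourier_neg_apply (j : Fin n → ℤ) (x : UnitAddTorus (Fin n)) :
    UnitAddTorus.mFourier j (-x) = UnitAddTorus.mFourier (-j) x := by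
  simp [UnitAddTorus.mFourier, fourier_apply]

lemma mFourier_single_coe (j : Fin n → ℤ) (i : Fin n) (t : ℝ) :
    UnitAddTorus.mFourier j (Pi.single i (t : UnitAddCircle)) =
      Complex.exp (2 * Real.pi * Complex.I * (j i : ℂ) * t) := by
  simp only [UnitAddTorus.mFourier, ContinuousMap.coe_mk]
  rw [Finset.prod_eq_single i]
  · simp
  · intro b _ hb
    simp [hb]
  · simp

lemma norm_mFourier_apply (j : Fin n → ℤ) (x : UnitAddTorus (Fin n)) :
    ‖UnitAddTorus.mFourier j x‖ = 1 := by
  simp only [UnitAddTorus.mFourier, ContinuousMap.coe_mk, norm_prod, fourier_apply, Circle.norm_coe,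
    Finset.prod_const_one]

/-- The Fourier coefficient `∫ e^{-2πi j·x} u(x) dx`. -/
def torusCoeff (u : UnitAddTorus (Fin n) → ℂ) (j : Fin n → ℤ) : ℂ :=
  ∫ x, UnitAddTorus.mFourier (-j) x * u x ∂(haarTorus n)

lemma integrable_mFourier_mul (hu : SmoothTorus u) (j : Fin n → ℤ) :
    Integrable (fun x => UnitAddTorus.mFourier j x * u x) (haarTorus n) :=
  ((UnitAddTorus.mFourier j).continuous.mul hu.continuous).integrable_of_hasCompactSupport
    (HasCompactSupport.of_compactSpace _)

lemma torusCoeff_sub (hu : SmoothTorus u) (hv : SmoothTorus v) (j : Fin n → ℤ) :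
    torusCoeff (u - v) j = torusCoeff u j - torusCoeff v j := by
  simp only [torusCoeff, Pi.sub_apply, mul_sub]
  exact integral_sub (integrable_mFourier_mul hu _) (integrable_mFourier_mul hv _)

lemma torusCoeff_const_mul (c : ℂ) (u : UnitAddTorus (Fin n) → ℂ) (j : Fin n → ℤ) :
    torusCoeff (fun x => c * u x) j = c * torusCoeff u j := by
  simp only [torusCoeff, mul_left_comm _ c]
  exact integral_const_mul c _

lemma torusCoeff_sum {ι : Type*} (s : Finset ι) {u : ι → UnitAddTorus (Fin n) → ℂ}
    (h : ∀ i ∈ s, SmoothTorus (u i)) (j : Fin n → ℤ) :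
    torusCoeff (fun x => ∑ i ∈ s, u i x) j = ∑ i ∈ s, torusCoeff (u i) j := by
  simp only [torusCoeff, Finset.mul_sum]
  exact integral_finsetSum s fun i hi => integrable_mFourier_mul (h i hi) _

lemma torusCoeff_comp_neg (u : UnitAddTorus (Fin n) → ℂ) (j : Fin n → ℤ) :
    torusCoeff (fun x => u (-x)) j = torusCoeff u (-j) := by
  unfold torusCoeff
  rw [← integral_neg_eq_self]
  simp [mFourier_neg_apply]

lemma norm_torusCoeff_le {C : ℝ} (h : ∀ x, ‖u x‖ ≤ C) (j : Fin n → ℤ) : ‖torusCoeff u j‖ ≤ C := by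
  have := norm_integral_le_of_norm_le_const (μ := haarTorus n)
    (f := fun x => UnitAddTorus.mFourier (-j) x * u x) (C := C)
    (Filter.Eventually.of_forall fun x => by rw [norm_mul, norm_mFourier_apply, one_mul]; exact h x)
  simpa [torusCoeff] using this

/-- In place of integration by parts, translation invariance: translating $u$ by $te_i$ multiplies
its coefficient by $e^{2\pi i j_it}$. Both sides are differentiated at $t=0$, one of them under the
integral. -/
lemma torusCoeff_torusD (hu : SmoothTorus u) (i : Fin n) (j : Fin n → ℤ) :
    torusCoeff (torusD i u) j = j i * torusCoeff u j := by
  have hpi : (2 * (Real.pi : ℂ) * Complex.I) ≠ 0 := by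
    simp [Real.pi_ne_zero, Complex.I_ne_zero]
  have htrans : ∀ t : ℝ, ∫ x, UnitAddTorus.mFourier (-j) x *
      u (x + Pi.single i (t : UnitAddCircle)) ∂(haarTorus n) =
        Complex.exp (2 * Real.pi * Complex.I * (j i : ℂ) * t) * torusCoeff u j := by
    intro t
    have h1 := integral_add_right_eq_self (μ := haarTorus n)
      (fun x => UnitAddTorus.mFourier (-j) (x - Pi.single i (t : UnitAddCircle)) * u x)
      (Pi.single i (t : UnitAddCircle))
    simp only [add_sub_cancel_right] at h1
    rw [h1, torusCoeff, ← integral_const_mul]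
    congr 1
    ext x
    rw [sub_eq_add_neg, mFourier_add_apply, mFourier_neg_apply, neg_neg, mFourier_single_coe]
    ring
  have hd1 : HasDerivAt (fun t : ℝ => ∫ x, UnitAddTorus.mFourier (-j) x *
      u (x + Pi.single i (t : UnitAddCircle)) ∂(haarTorus n))
      (2 * Real.pi * Complex.I * (j i : ℂ) * torusCoeff u j) 0 := by
    simp_rw [htrans]
    have h2 : HasDerivAt (fun t : ℝ => 2 * (Real.pi : ℂ) * Complex.I * (j i : ℂ) * (t : ℂ))
        (2 * Real.pi * Complex.I * (j i : ℂ) * 1) 0 :=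
      (Complex.ofRealCLM.hasDerivAt (x := (0 : ℝ))).const_mul _
    have h3 := h2.cexp.mul_const (torusCoeff u j)
    simpa using h3
  obtain ⟨B, hB⟩ := (hu.torusD i).exists_bound
  have hd2 := (hasDerivAt_integral_of_dominated_loc_of_deriv_le (μ := haarTorus n) (𝕜 := ℝ)
    (F := fun t x => UnitAddTorus.mFourier (-j) x * u (x + Pi.single i (t : UnitAddCircle)))
    (F' := fun t x => UnitAddTorus.mFourier (-j) x * (2 * (Real.pi : ℂ) * Complex.I *
        torusD i u (x + Pi.single i (t : UnitAddCircle))))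
    (bound := fun _ => ‖2 * (Real.pi : ℂ) * Complex.I‖ * B) (x₀ := (0 : ℝ)) (s := Set.univ)
    Filter.univ_mem ?_ ?_ ?_ ?_ ?_ ?_).2
  · have h4 := hd1.unique hd2
    have h5 : ∫ x, UnitAddTorus.mFourier (-j) x * (2 * (Real.pi : ℂ) * Complex.I *
        torusD i u (x + Pi.single i ((0 : ℝ) : UnitAddCircle))) ∂(haarTorus n) =
        2 * (Real.pi : ℂ) * Complex.I * torusCoeff (torusD i u) j := by
      rw [torusCoeff, ← integral_const_mul]
      congr 1
      ext x
      simp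
      ring
    rw [h5, mul_assoc (2 * (Real.pi : ℂ) * Complex.I)] at h4
    exact (mul_left_cancel₀ hpi h4).symm
  · refine Filter.Eventually.of_forall fun t => Continuous.aestronglyMeasurable ?_
    exact (UnitAddTorus.mFourier _).continuous.mul
      (hu.continuous.comp (continuous_id.add continuous_const))
  · simpa using integrable_mFourier_mul hu (-j)
  · refine Continuous.aestronglyMeasurable ?_
    exact (UnitAddTorus.mFourier _).continuous.mul (continuous_const.mul
      ((hu.torusD i).continuous.comp (continuous_id.add continuous_const)))
  · refine Filter.Eventually.of_forall fun x t _ => ?_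
    rw [norm_mul, norm_mFourier_apply, one_mul, norm_mul]
    gcongr
    exact hB _
  · exact integrable_const _
  · exact Filter.Eventually.of_forall fun x t _ => (hu.hasDerivAt_translate i x t).const_mul _

lemma SmoothTorus.torusDFall (hu : SmoothTorus u) (i : Fin n) (r : ℕ) :
    SmoothTorus (torusDFall i r u) := by
  induction r with
  | zero => exact hu
  | succ r ih => exact (ih.torusD i).sub (ih.const_mul r)

lemma torusCoeff_torusDFall (hu : SmoothTorus u) (i : Fin n) (r : ℕ) (j : Fin n → ℤ) :
    torusCoeff (torusDFall i r u) j = fallFact (j i) r * torusCoeff u j := by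
  induction r with
  | zero => simp [torusDFall, fallFact_zero]
  | succ r ih =>
    have h := hu.torusDFall i r
    have h1 := torusCoeff_sub (h.torusD i) (h.const_mul r) j
    rw [torusCoeff_torusD h, torusCoeff_const_mul, ih] at h1
    rw [fallFact_succ]
    exact h1.trans (by ring)

lemma smooth_and_torusCoeff_torusDMulti (hu : SmoothTorus u) (β : Fin n → ℕ) :
    SmoothTorus (torusDMulti β u) ∧
      ∀ j, torusCoeff (torusDMulti β u) j = fallMulti j β * torusCoeff u j := by
  unfold torusDMulti fallMulti
  simp_rw [Fin.prod_univ_def]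
  induction List.finRange n with
  | nil => simpa using hu
  | cons a l ih =>
    refine ⟨ih.1.torusDFall a _, fun j => ?_⟩
    rw [List.foldr_cons, torusCoeff_torusDFall ih.1, ih.2, List.map_cons, List.prod_cons, mul_assoc]

lemma norm_le_tsum_torusCoeff (hu : SmoothTorus u) (h : Summable fun j => ‖torusCoeff u j‖)
    (x : UnitAddTorus (Fin n)) : ‖u x‖ ≤ ∑' j, ‖torusCoeff u j‖ := by
  have h1 := UnitAddTorus.hasSum_mFourier_series_apply_of_summable (f := ⟨u, hu.continuous⟩)
    h.of_norm x
  have h2 : u x = ∑' j, torusCoeff u j • UnitAddTorus.mFourier j x := h1.tsum_eq.symm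
  rw [h2]
  have h3 : ∀ j, ‖torusCoeff u j • UnitAddTorus.mFourier j x‖ = ‖torusCoeff u j‖ := fun j => by
    rw [norm_smul, norm_mFourier_apply, mul_one]
  refine (norm_tsum_le_tsum_norm (by simpa only [h3] using h)).trans (le_of_eq ?_)
  simp only [h3]

/-! ### Fourier series with rapidly decreasing coefficients -/

lemma rapidlyDecreasing_iff {f : (Fin n → ℤ) → ℂ} :
    RapidlyDecreasing f ↔ ∀ L : ℕ, ∃ C : ℝ, ∀ k, bracket k ^ L * ‖f k‖ ≤ C := by
  constructor
  · intro h L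
    obtain ⟨C, hC⟩ := h L
    refine ⟨(n + 1) ^ L * C, fun k => ?_⟩
    have h1 := bracket_pos k
    calc bracket k ^ L * ‖f k‖ ≤ ((n + 1) * (1 + znorm k)) ^ L * ‖f k‖ := by
          gcongr
          exact bracket_le_znorm k
      _ = (n + 1) ^ L * ((1 + znorm k) ^ L * ‖f k‖) := by rw [mul_pow, mul_assoc]
      _ ≤ _ := by
          gcongr
          exact hC k
  · intro h L
    obtain ⟨C, hC⟩ := h L
    refine ⟨C, fun k => le_trans ?_ (hC k)⟩
    have := znorm_nonneg k
    gcongr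
    exact znorm_le_bracket k

lemma norm_le_of_bracket_bound {C r : ℝ} {L : ℕ} {j : Fin n → ℤ} (h : bracket j ^ (L + 2 * n) * r ≤ C) :
    bracket j ^ L * r ≤ C * (bracket j ^ (2 * n))⁻¹ := by
  have hb := pow_pos (bracket_pos j) (2 * n)
  rw [← div_eq_mul_inv, le_div_iff₀ hb]
  calc _ = bracket j ^ (L + 2 * n) * r := by ring
    _ ≤ C := h

lemma RapidlyDecreasing.summable_bracket_mul {f : (Fin n → ℤ) → ℂ} (hf : RapidlyDecreasing f)
    (L : ℕ) : Summable fun k => bracket k ^ L * ‖f k‖ := by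
  obtain ⟨C, hC⟩ := rapidlyDecreasing_iff.1 hf (L + 2 * n)
  exact Summable.of_nonneg_of_le
    (fun k => mul_nonneg (pow_nonneg (bracket_pos k).le _) (norm_nonneg _))
    (fun k => norm_le_of_bracket_bound (hC k)) ((summable_bracket_inv n).mul_left C)

lemma RapidlyDecreasing.summable_norm {f : (Fin n → ℤ) → ℂ} (hf : RapidlyDecreasing f) :
    Summable fun k => ‖f k‖ := by
  simpa using hf.summable_bracket_mul 0

/-- The function on the torus with Fourier coefficients `b`. -/
def torusSeries (b : (Fin n → ℤ) → ℂ) (x : UnitAddTorus (Fin n)) : ℂ :=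
  ∑' j, b j * UnitAddTorus.mFourier j x

/-- The linear form `y ↦ 2π j·y`. -/
def phase (j : Fin n → ℤ) : (Fin n → ℝ) →L[ℝ] ℝ :=
  ∑ i, (2 * Real.pi * (j i : ℝ)) • ContinuousLinearMap.proj i

lemma norm_phase_le (j : Fin n → ℤ) : ‖phase j‖ ≤ 2 * Real.pi * bracket j := by
  have hpi := Real.pi_pos
  refine ContinuousLinearMap.opNorm_le_bound _ (by have := bracket_pos j; positivity) fun y => ?_
  have h1 : phase j y = ∑ i, 2 * Real.pi * (j i : ℝ) * y i := by simp [phase]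
  rw [h1]
  refine (norm_sum_le _ _).trans ?_
  calc ∑ i, ‖2 * Real.pi * (j i : ℝ) * y i‖ ≤ ∑ i, 2 * Real.pi * |(j i : ℝ)| * ‖y‖ := by
        refine Finset.sum_le_sum fun i _ => ?_
        rw [norm_mul, norm_mul, Real.norm_of_nonneg (by positivity : 0 ≤ 2 * Real.pi),
          Real.norm_eq_abs]
        gcongr
        exact norm_le_pi_norm y i
    _ = 2 * Real.pi * (∑ i, |(j i : ℝ)|) * ‖y‖ := by rw [Finset.mul_sum, Finset.sum_mul]
    _ ≤ _ := by
        gcongr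
        simp [bracket]

lemma mFourier_toTorus (j : Fin n → ℤ) (y : Fin n → ℝ) :
    UnitAddTorus.mFourier j (toTorus y) = Complex.exp (Complex.I * (phase j y : ℝ)) := by
  have h1 : phase j y = ∑ i, 2 * Real.pi * (j i : ℝ) * y i := by simp [phase]
  rw [h1]
  push_cast
  rw [Finset.mul_sum, Complex.exp_sum]
  simp only [UnitAddTorus.mFourier, ContinuousMap.coe_mk, toTorus]
  refine Finset.prod_congr rfl fun i _ => ?_
  rw [fourier_coe_apply]
  congr 1
  push_cast
  ring

lemma contDiff_exp_I_mul : ContDiff ℝ ((⊤ : ℕ∞) : WithTop ℕ∞)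
    fun t : ℝ => Complex.exp (Complex.I * t) :=
  (contDiff_const.mul Complex.ofRealCLM.contDiff).cexp

lemma iteratedDeriv_exp_I_mul (m : ℕ) (t : ℝ) :
    iteratedDeriv m (fun t : ℝ => Complex.exp (Complex.I * t)) t =
      Complex.I ^ m * Complex.exp (Complex.I * t) := by
  induction m generalizing t with
  | zero => simp
  | succ m ih =>
    rw [iteratedDeriv_succ, funext ih]
    have h1 : HasDerivAt (fun t : ℝ => Complex.I * (t : ℂ)) (Complex.I * 1) t :=
      (Complex.ofRealCLM.hasDerivAt (x := t)).const_mul _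
    rw [(h1.cexp.const_mul (Complex.I ^ m)).deriv]
    ring

/-- A character is $e^{it}$ composed with a linear form, so each derivative costs at most the norm
of that form. -/
lemma norm_iteratedFDeriv_mFourier_le (m : ℕ) (j : Fin n → ℤ) (y : Fin n → ℝ) :
    ‖iteratedFDeriv ℝ m (fun y => UnitAddTorus.mFourier j (toTorus y)) y‖ ≤
      (2 * Real.pi * bracket j) ^ m := by
  have h1 : (fun y => UnitAddTorus.mFourier j (toTorus y)) =
      (fun t : ℝ => Complex.exp (Complex.I * t)) ∘ phase j :=
    funext fun y => mFourier_toTorus j y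
  rw [h1, (phase j).iteratedFDeriv_comp_right contDiff_exp_I_mul y (by exact_mod_cast le_top)]
  refine (ContinuousMultilinearMap.norm_compContinuousLinearMap_le _ _).trans ?_
  rw [norm_iteratedFDeriv_eq_norm_iteratedDeriv, iteratedDeriv_exp_I_mul, norm_mul, norm_pow,
    Complex.norm_I, one_pow, one_mul, mul_comm Complex.I, Complex.norm_exp_ofReal_mul_I, one_mul]
  simp only [Finset.prod_const, Finset.card_univ, Fintype.card_fin]
  gcongr
  exact norm_phase_le j

lemma smoothTorus_mFourier (j : Fin n → ℤ) : SmoothTorus fun x => UnitAddTorus.mFourier j x := by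
  have h1 : (fun y => UnitAddTorus.mFourier j (toTorus y)) =
      (fun t : ℝ => Complex.exp (Complex.I * t)) ∘ phase j :=
    funext fun y => mFourier_toTorus j y
  change ContDiff ℝ _ (fun y => UnitAddTorus.mFourier j (toTorus y))
  rw [h1]
  exact contDiff_exp_I_mul.comp (phase j).contDiff

/-- Termwise differentiation: an $m$-th derivative costs $m$ powers of the bracket, which leaves a
summable majorant. -/
lemma smoothTorus_torusSeries {b : (Fin n → ℤ) → ℂ} (hb : RapidlyDecreasing b) :
    SmoothTorus (torusSeries b) := by
  refine contDiff_tsum (v := fun m j => ‖b j‖ * (2 * Real.pi * bracket j) ^ m)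
    (fun j => (smoothTorus_mFourier j).const_mul (b j)) (fun m _ => ?_) fun m j y hm => ?_
  · refine ((hb.summable_bracket_mul m).mul_left ((2 * Real.pi) ^ m)).congr fun j => ?_
    rw [mul_pow]
    ring
  · have h1 : ContDiff ℝ m fun y => UnitAddTorus.mFourier j (toTorus y) :=
      (smoothTorus_mFourier j).of_le (by exact_mod_cast le_top)
    have h2 := iteratedFDeriv_const_smul_apply (a := b j) (h1.contDiffAt (x := y))
    have h3 : ‖iteratedFDeriv ℝ m (b j • fun y => UnitAddTorus.mFourier j (toTorus y)) y‖ ≤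
        ‖b j‖ * (2 * Real.pi * bracket j) ^ m := by
      rw [h2, norm_smul]
      gcongr
      exact norm_iteratedFDeriv_mFourier_le m j y
    exact h3

lemma torusCoeff_mFourier (i j : Fin n → ℤ) :
    torusCoeff (fun x => UnitAddTorus.mFourier i x) j = if i = j then 1 else 0 := by
  have h := (orthonormal_iff_ite.1 (UnitAddTorus.orthonormal_mFourier (d := Fin n))) j i
  rw [ContinuousMap.inner_toLp] at h
  have h1 : (if i = j then (1 : ℂ) else 0) = if j = i then 1 else 0 := by simp only [eq_comm]
  rw [h1, ← h, torusCoeff]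
  refine integral_congr_ae (Filter.Eventually.of_forall fun x => ?_)
  simp only [UnitAddTorus.mFourier_neg]
  rw [mul_comm]

lemma torusCoeff_torusSeries {b : (Fin n → ℤ) → ℂ} (hb : RapidlyDecreasing b) (j : Fin n → ℤ) :
    torusCoeff (torusSeries b) j = b j := by
  have h1 := hasSum_integral_of_summable_integral_norm (μ := haarTorus n)
    (F := fun i x => UnitAddTorus.mFourier (-j) x * (b i * UnitAddTorus.mFourier i x))
    (fun i => integrable_mFourier_mul ((smoothTorus_mFourier i).const_mul (b i)) _) (by
      simpa [norm_mFourier_apply] using hb.summable_norm)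
  simp only [tsum_mul_left] at h1
  have h2 : ∀ i, ∫ x, UnitAddTorus.mFourier (-j) x * (b i * UnitAddTorus.mFourier i x)
      ∂(haarTorus n) = if i = j then b j else 0 := fun i => by
    have := torusCoeff_const_mul (b i) (fun x => UnitAddTorus.mFourier i x) j
    rw [torusCoeff_mFourier] at this
    refine this.trans ?_
    split_ifs with h <;> simp [h]
  simp only [h2] at h1
  exact h1.unique (hasSum_ite_eq j (b j))

/-! ### Commuting monomials with differences -/

lemma multiIdx_induction {n : ℕ} {P : (Fin n → ℕ) → Prop} (h0 : P 0)
    (hs : ∀ i α, P α → P (Pi.single i 1 + α)) (α : Fin n → ℕ) : P α := by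
  induction hN : mlen α generalizing α with
  | zero =>
    have : α = 0 := by
      ext i
      exact (Finset.sum_eq_zero_iff.1 hN) i (Finset.mem_univ i)
    rwa [this]
  | succ N ih =>
    obtain ⟨i, hi⟩ : ∃ i, α i ≠ 0 := by
      by_contra! h
      simp [mlen, h] at hN
    have e : α = Pi.single i 1 + (α - Pi.single i 1) := by
      ext j
      by_cases h : j = i
      · subst h
        simp
        omega
      · simp [h]
    have h1 : mlen (α - Pi.single i 1) = N := by
      rw [e, mlen_add, mlen_single] at hN
      omega
    rw [e]
    exact hs i _ (ih _ h1)

/-- Intended for `φ` a Fourier coefficient, which is shown to respect subtraction for smooth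
functions; hence the predicate `P` is carried along. -/
lemma diffMulti_map {n : ℕ} {E F : Type*} [AddCommGroup E] [AddCommGroup F] {P : E → Prop}
    {φ : E → F} (hP : ∀ u v, P u → P v → P (u - v))
    (hφ : ∀ u v, P u → P v → φ (u - v) = φ u - φ v) {g : (Fin n → ℤ) → E} (hg : ∀ k, P (g k))
    (α : Fin n → ℕ) (k : Fin n → ℤ) :
    P (diffMulti α g k) ∧ φ (diffMulti α g k) = diffMulti α (fun l => φ (g l)) k := by
  have hiter : ∀ (i : Fin n) (r : ℕ) (g : (Fin n → ℤ) → E), (∀ k, P (g k)) →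
      (∀ k, P ((diff i)^[r] g k)) ∧
        (fun k => φ ((diff i)^[r] g k)) = (diff i)^[r] fun k => φ (g k) := by
    intro i r g hg
    induction r with
    | zero => exact ⟨hg, rfl⟩
    | succ r ih =>
      simp only [Function.iterate_succ_apply']
      refine ⟨fun k => hP _ _ (ih.1 _) (ih.1 _), ?_⟩
      rw [← ih.2]
      ext k
      exact hφ _ _ (ih.1 _) (ih.1 _)
  unfold diffMulti
  suffices h : ∀ l : List (Fin n), (∀ k, P (l.foldr (fun j g => (diff j)^[α j] g) g k)) ∧
      (fun k => φ (l.foldr (fun j g => (diff j)^[α j] g) g k)) =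
        l.foldr (fun j g => (diff j)^[α j] g) fun k => φ (g k) from
    ⟨(h _).1 k, congrFun (h _).2 k⟩
  intro l
  induction l with
  | nil => exact ⟨hg, rfl⟩
  | cons a l ih =>
    simp only [List.foldr_cons]
    rw [← ih.2]
    exact hiter a (α a) _ ih.1

section Commutator

variable {n : ℕ}

lemma zpowMulti_single_add (k : Fin n → ℤ) (i : Fin n) (γ : Fin n → ℕ) :
    zpowMulti k (Pi.single i 1 + γ) = k i * zpowMulti k γ := by
  simp only [zpowMulti, Pi.add_apply, pow_add, Finset.prod_mul_distrib]
  congr 1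
  rw [Finset.prod_eq_single i]
  · simp
  · intro b _ hb
    simp [hb]
  · simp

lemma zpowMulti_shift_of_eq_zero (k : Fin n → ℤ) {i : Fin n} {γ : Fin n → ℕ} (h : γ i = 0) :
    zpowMulti (k + Pi.single i 1) γ = zpowMulti k γ := by
  refine Finset.prod_congr rfl fun j _ => ?_
  by_cases hj : j = i
  · subst hj
    simp [h]
  · simp [hj]

lemma diffMulti_shift (α : Fin n → ℕ) (v : Fin n → ℤ) (g : (Fin n → ℤ) → ℂ) (k : Fin n → ℤ) :
    diffMulti α (fun l => g (l + v)) k = diffMulti α g (k + v) := by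
  have e : (fun l => g (l + v)) = shiftAlg (AddMonoidAlgebra.single v 1) g := by
    ext l
    simp [shiftAlg_single]
  rw [e, diffMulti_eq_shiftAlg, shiftAlg_comm, shiftAlg_single, one_mul, diffMulti_eq_shiftAlg]

lemma diffMulti_single_add (i : Fin n) (α : Fin n → ℕ) (g : (Fin n → ℤ) → ℂ) :
    diffMulti (Pi.single i 1 + α) g = diffMulti α (diff i g) := by
  rw [add_comm, diffMulti_add, diffMulti_single]

lemma diff_diffMulti (i : Fin n) (α : Fin n → ℕ) (g : (Fin n → ℤ) → ℂ) :
    diff i (diffMulti α g) = diffMulti (Pi.single i 1 + α) g := by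
  rw [diffMulti_add, diffMulti_single]

/-- Here $k^\gamma$ does not depend on $k_i$, so $\Delta_{k_i}$ passes through it. -/
lemma diffMulti_monomial_of_eq_zero {i : Fin n} {γ : Fin n → ℕ} (h : γ i = 0) (α α' : Fin n → ℕ)
    (g : (Fin n → ℤ) → ℂ) :
    diffMulti (Pi.single i 1 + α) (fun l => (zpowMulti l γ : ℂ) * diffMulti (α' + γ) g l) =
      diffMulti α fun l => (zpowMulti l γ : ℂ) * diffMulti (Pi.single i 1 + α' + γ) g l := by
  rw [diffMulti_single_add]
  congr 1
  ext l
  rw [add_assoc, ← diff_diffMulti]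
  simp only [diff]
  rw [zpowMulti_shift_of_eq_zero l h]
  ring

/-- The discrete Leibniz rule $\Delta_i(l_ih)(l)=l_i\Delta_ih(l)+h(l+e_i)$. The second term has lost
one factor $l_i$, so one of its differences now counts towards the order. -/
lemma diffMulti_monomial_single_add {i : Fin n} {γ : Fin n → ℕ} (h : γ i = 0) (α α' : Fin n → ℕ)
    (g : (Fin n → ℤ) → ℂ) (k : Fin n → ℤ) :
    diffMulti (Pi.single i 1 + α) (fun l => (zpowMulti l (Pi.single i 1 + γ) : ℂ) *
        diffMulti (α' + (Pi.single i 1 + γ)) g l) k =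
      diffMulti α (fun l => (zpowMulti l (Pi.single i 1 + γ) : ℂ) *
        diffMulti (Pi.single i 1 + α' + (Pi.single i 1 + γ)) g l) k +
      diffMulti α (fun l => (zpowMulti l γ : ℂ) * diffMulti (Pi.single i 1 + α' + γ) g l)
        (k + Pi.single i 1) := by
  rw [diffMulti_single_add, ← diffMulti_shift]
  have e : ∀ u v : (Fin n → ℤ) → ℂ, diffMulti α u k + diffMulti α v k = diffMulti α (u + v) k := by
    intro u v
    simp only [diffMulti_eq_shiftAlg, map_add, Pi.add_apply]
  rw [e]
  congr 1
  ext l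
  have e1 : Pi.single i 1 + α' + (Pi.single i 1 + γ) =
      Pi.single i 1 + (α' + (Pi.single i 1 + γ)) := by rw [add_assoc]
  have e2 : Pi.single i 1 + α' + γ = α' + (Pi.single i 1 + γ) := by
    rw [add_comm (Pi.single i 1) α', add_assoc]
  rw [e1, e2, ← diff_diffMulti]
  simp only [diff, Pi.add_apply]
  rw [zpowMulti_shift_of_eq_zero (γ := γ) l h, zpowMulti_single_add, zpowMulti_single_add,
    zpowMulti_shift_of_eq_zero (γ := γ) l h]
  simp
  ring

variable {Λ : (Fin n → ℤ) → ℝ} {ρ μ m : ℝ} {a : (Fin n → ℤ) → (Fin n → ℤ) → ℂ}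

/-- The estimate for `Δ^α k^γ Δ^{α'+γ} a` in a kernel of order `m`. -/
def MixedBound (Λ : (Fin n → ℤ) → ℝ) (ρ m : ℝ) (a : (Fin n → ℤ) → (Fin n → ℤ) → ℂ)
    (α α' γ : Fin n → ℕ) : Prop :=
  DecayBound (fun k => Λ k ^ (m - ρ * (mlen (α + α') : ℝ))) fun k j =>
    diffMulti α (fun l => (zpowMulti l γ : ℂ) * diffMulti (α' + γ) (fun l => a l j) l) k

lemma exists_eq_single_add {γ : Fin n → ℕ} (hγ : ∀ i, γ i ≤ 1) {i : Fin n} (hi : γ i ≠ 0) :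
    ∃ γ' : Fin n → ℕ, γ = Pi.single i 1 + γ' ∧ γ' i = 0 ∧ ∀ j, γ' j ≤ 1 := by
  have := hγ i
  refine ⟨Function.update γ i 0, ?_, by simp, fun j => ?_⟩
  · ext j
    by_cases h : j = i
    · subst h
      simp
      omega
    · simp [h]
  · by_cases h : j = i
    · subst h
      simp
    · simpa [h] using hγ j

/-- Outer differences are moved inside one at a time; the Leibniz term has a smaller $\gamma$, and
its shift is harmless because powers of $\Lambda$ are moderate. -/
lemma MixedBound.of_left_zero (hΛ : IsWeight μ Λ)
    (h : ∀ α' γ, (∀ i, γ i ≤ 1) → MixedBound Λ ρ m a 0 α' γ) (α : Fin n → ℕ) :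
    ∀ α' γ, (∀ i, γ i ≤ 1) → MixedBound Λ ρ m a α α' γ := by
  induction α using multiIdx_induction with
  | h0 => exact h
  | hs i α ih =>
    intro α' γ hγ
    have e : Pi.single i 1 + α + α' = α + (Pi.single i 1 + α') := by
      rw [add_comm (Pi.single i 1) α, add_assoc]
    unfold MixedBound at ih ⊢
    rw [e]
    by_cases hi : γ i = 0
    · simp only [diffMulti_monomial_of_eq_zero hi]
      exact ih _ γ hγ
    · obtain ⟨γ', rfl, hi', hγ'⟩ := exists_eq_single_add hγ hi
      simp only [diffMulti_monomial_single_add hi']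
      exact (ih _ _ hγ).add ((ih _ _ hγ').shift (hΛ.moderate.rpow hΛ.pos _) _)

/-- The Leibniz identity is read backwards, solving for the term with the extra inner difference.
The case $\gamma_i=0$ comes first since it supplies the term to be subtracted when $\gamma_i=1$. -/
lemma MixedBound.of_middle_zero (hΛ : IsWeight μ Λ)
    (h : ∀ α γ, (∀ i, γ i ≤ 1) → MixedBound Λ ρ m a α 0 γ) (α' : Fin n → ℕ) :
    ∀ α γ, (∀ i, γ i ≤ 1) → MixedBound Λ ρ m a α α' γ := by
  induction α' using multiIdx_induction with
  | h0 => exact h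
  | hs i α' ih =>
    intro α γ hγ
    have e : Pi.single i 1 + α + α' = α + (Pi.single i 1 + α') := by
      rw [add_comm (Pi.single i 1) α, add_assoc]
    have base : ∀ γ, (∀ i, γ i ≤ 1) → γ i = 0 → MixedBound Λ ρ m a α (Pi.single i 1 + α') γ := by
      intro γ hγ hi
      have := ih (Pi.single i 1 + α) γ hγ
      unfold MixedBound at this ⊢
      rw [e] at this
      simpa only [diffMulti_monomial_of_eq_zero hi] using this
    by_cases hi : γ i = 0
    · exact base γ hγ hi
    · obtain ⟨γ', rfl, hi', hγ'⟩ := exists_eq_single_add hγ hi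
      have h1 := ih (Pi.single i 1 + α) _ hγ
      have h2 := base γ' hγ' hi'
      unfold MixedBound at h1 h2 ⊢
      rw [e] at h1
      simp only [diffMulti_monomial_single_add hi'] at h1
      have h3 := h1.sub (h2.shift (hΛ.moderate.rpow hΛ.pos _) (Pi.single i 1))
      simpa only [add_sub_cancel_right] using h3

lemma abs_zpowMulti_le (k : Fin n → ℤ) (γ : Fin n → ℕ) :
    |(zpowMulti k γ : ℝ)| ≤ ∏ i, (1 + |(k i : ℝ)|) ^ γ i := by
  simp only [zpowMulti, Int.cast_prod, Int.cast_pow, Finset.abs_prod, abs_pow]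
  gcongr
  linarith

/-- A nonzero integer satisfies $1+|k_i|\le 2|k_i|$; coordinates with $k_i=0$ contribute $1$ and are
dropped from $\delta$. -/
lemma prod_one_add_abs_le (k : Fin n → ℤ) {γ : Fin n → ℕ} (hγ : ∀ i, γ i ≤ 1) :
    ∃ δ ≤ γ, ∏ i, (1 + |(k i : ℝ)|) ^ γ i ≤ 2 ^ n * |(zpowMulti k δ : ℝ)| := by
  classical
  refine ⟨fun i => if k i = 0 then 0 else γ i, fun i => by dsimp only; split_ifs <;> simp, ?_⟩
  simp only [zpowMulti, Int.cast_prod, Int.cast_pow, Finset.abs_prod, abs_pow]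
  have e : (2 : ℝ) ^ n = ∏ _i : Fin n, (2 : ℝ) := by simp
  rw [e, ← Finset.prod_mul_distrib]
  refine Finset.prod_le_prod (fun i _ => by positivity) fun i _ => ?_
  by_cases h : k i = 0
  · simp [h]
  · have h1 : (1 : ℝ) ≤ |(k i : ℝ)| := by exact_mod_cast Int.one_le_abs h
    rw [if_neg h]
    have := hγ i
    interval_cases γ i
    · simp
    · simp
      linarith

/-- Membership in `KernelClass` through the symbols `k^γ Δ^γ a`. -/
lemma kernelClass_iff (hΛ : IsWeight μ Λ) (hρ : 0 < ρ) :
    KernelClass Λ ρ m a ↔ ∀ α γ, (∀ i, γ i ≤ 1) → MixedBound Λ ρ m a α 0 γ := by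
  constructor
  · intro h α
    refine MixedBound.of_left_zero hΛ (fun α' γ hγ => ?_) α 0
    intro L
    obtain ⟨C, hC, hb⟩ := h α' γ hγ L
    refine ⟨C, hC, fun k j => ?_⟩
    have hw : 0 < ∏ i, (1 + |(k i : ℝ)|) ^ γ i := Finset.prod_pos fun i _ => by positivity
    have h1 := hb k j
    rw [symWeight, ← mul_assoc, ← div_eq_mul_inv, le_div_iff₀ hw] at h1
    rw [zero_add]
    simp only [diffMulti_zero, norm_mul, Complex.norm_intCast]
    refine le_trans ?_ h1
    rw [mul_left_comm, mul_comm]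
    have := pow_pos (bracket_pos j) L
    gcongr
    exact abs_zpowMulti_le k γ
  · intro h α γ hγ L
    have h1 : ∀ δ : Fin n → ℕ, ∃ C : ℝ, 0 < C ∧ (δ ≤ γ → ∀ k j, bracket j ^ L *
        (|(zpowMulti k δ : ℝ)| * ‖diffMulti (α + γ) (fun l => a l j) k‖) ≤
          C * Λ k ^ (m - ρ * (mlen α : ℝ))) := by
      intro δ
      by_cases hδ : δ ≤ γ
      -- The differences in $\gamma$ not matched by $\delta$ count as extra order, which only
      -- strengthens the bound as $\Lambda$ is bounded below.
      · obtain ⟨C, hC, hb⟩ := MixedBound.of_middle_zero hΛ h (α + (γ - δ)) 0 δ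
          (fun i => (hδ i).trans (hγ i)) L
        have e : α + (γ - δ) + δ = α + γ := by
          rw [add_assoc, tsub_add_cancel_of_le hδ]
        obtain ⟨C', hC', hb'⟩ := hΛ.rpow_le_rpow (s := m - ρ * (mlen (α + (γ - δ)) : ℝ))
          (t := m - ρ * (mlen α : ℝ)) (by
            rw [mlen_add]
            push_cast
            have : 0 ≤ ρ * (mlen (γ - δ) : ℝ) := by positivity
            linarith)
        refine ⟨C * C', by positivity, fun _ k j => ?_⟩
        have h2 := hb k j
        simp only [diffMulti_zero, norm_mul, Complex.norm_intCast, zero_add, e] at h2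
        refine h2.trans ?_
        rw [mul_assoc]
        gcongr
        exact hb' k
      · exact ⟨1, one_pos, fun h => absurd h hδ⟩
    choose C hC hb using h1
    -- The useful $\delta$ depends on $k$; summing over all $\delta\le\gamma$ makes the constant
    -- uniform.
    refine ⟨2 ^ n * ∑ δ ∈ Finset.Iic γ, C δ, ?_, fun k j => ?_⟩
    · have : 0 < ∑ δ ∈ Finset.Iic γ, C δ :=
        Finset.sum_pos (fun δ _ => hC δ) ⟨γ, by simp⟩
      positivity
    · obtain ⟨δ, hδ, hk⟩ := prod_one_add_abs_le k hγ
      have hw : 0 < ∏ i, (1 + |(k i : ℝ)|) ^ γ i := Finset.prod_pos fun i _ => by positivity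
      have hΛk := Real.rpow_pos_of_pos (hΛ.pos k) (m - ρ * (mlen α : ℝ))
      have hbj := pow_pos (bracket_pos j) L
      rw [symWeight, ← mul_assoc, ← div_eq_mul_inv, le_div_iff₀ hw]
      calc bracket j ^ L * ‖diffMulti (α + γ) (fun l => a l j) k‖ *
            ∏ i, (1 + |(k i : ℝ)|) ^ γ i
          ≤ bracket j ^ L * ‖diffMulti (α + γ) (fun l => a l j) k‖ *
            (2 ^ n * |(zpowMulti k δ : ℝ)|) := by gcongr
        _ = 2 ^ n * (bracket j ^ L *
            (|(zpowMulti k δ : ℝ)| * ‖diffMulti (α + γ) (fun l => a l j) k‖)) := by ring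
        _ ≤ 2 ^ n * (C δ * Λ k ^ (m - ρ * (mlen α : ℝ))) :=
            mul_le_mul_of_nonneg_left (hb δ hδ k j) (by positivity)
        _ ≤ 2 ^ n * ((∑ δ ∈ Finset.Iic γ, C δ) * Λ k ^ (m - ρ * (mlen α : ℝ))) := by
            gcongr
            exact Finset.single_le_sum (fun δ _ => (hC δ).le) (by simpa using hδ)
        _ = _ := by ring

end Commutator

/-! ### Symbols and their Fourier coefficients -/

section Symbols

variable {n : ℕ} {Λ : (Fin n → ℤ) → ℝ} {ρ μ m : ℝ}
  {τ : (Fin n → ℤ) → UnitAddTorus (Fin n) → ℂ}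

lemma smooth_and_torusCoeff_diffMulti (hτ : ∀ k, SmoothTorus (τ k)) (α : Fin n → ℕ)
    (k : Fin n → ℤ) : SmoothTorus (diffMulti α τ k) ∧
      ∀ j, torusCoeff (diffMulti α τ k) j = diffMulti α (fun l => torusCoeff (τ l) j) k := by
  have h := fun j => diffMulti_map (P := SmoothTorus) (φ := fun u => torusCoeff u j)
    (fun u v hu hv => hu.sub hv) (fun u v hu hv => torusCoeff_sub hu hv j) hτ α k
  exact ⟨(h 0).1, fun j => (h j).2⟩

lemma norm_fallMulti_le (j : Fin n → ℤ) (β : Fin n → ℕ) :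
    ‖fallMulti j β‖ ≤ (∏ i, (1 + β i : ℝ) ^ β i) * bracket j ^ mlen β := by
  rw [fallMulti, norm_prod, mlen, ← Finset.prod_pow_eq_pow_sum, ← Finset.prod_mul_distrib]
  refine Finset.prod_le_prod (fun _ _ => norm_nonneg _) fun i _ => ?_
  refine (norm_fallFact_le _ _).trans ?_
  have := one_add_abs_le_bracket j i
  gcongr

lemma fallMulti_single_add (j : Fin n → ℤ) (i : Fin n) (β : Fin n → ℕ) :
    fallMulti j (Pi.single i 1 + β) = ((j i : ℂ) - β i) * fallMulti j β := by
  classical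
  unfold fallMulti
  rw [← Finset.mul_prod_erase _ _ (Finset.mem_univ i),
    ← Finset.mul_prod_erase _ (fun i => fallFact (j i) (β i)) (Finset.mem_univ i), ← mul_assoc]
  congr 1
  · simp only [Pi.add_apply, Pi.single_eq_same]
    rw [add_comm 1, fallFact_succ, mul_comm]
  · refine Finset.prod_congr rfl fun l hl => ?_
    simp [Finset.ne_of_mem_erase hl]

/-- From $j_i\,j^{(\beta)}=j^{(\beta+e_i)}+\beta_i\,j^{(\beta)}$, so bounds against falling
factorials yield bounds against genuine powers. -/
lemma bracket_mul_norm_fallMulti_le (j : Fin n → ℤ) (β : Fin n → ℕ) :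
    bracket j * ‖fallMulti j β‖ ≤
      (1 + mlen β) * ‖fallMulti j β‖ + ∑ i, ‖fallMulti j (Pi.single i 1 + β)‖ := by
  have h1 : ∀ i, |(j i : ℝ)| * ‖fallMulti j β‖ ≤
      β i * ‖fallMulti j β‖ + ‖fallMulti j (Pi.single i 1 + β)‖ := by
    intro i
    rw [fallMulti_single_add, norm_mul, ← add_mul]
    gcongr
    have h2 : |(j i : ℝ)| = ‖(j i : ℂ)‖ := by rw [Complex.norm_intCast]
    rw [h2]
    have h3 := norm_add_le (β i : ℂ) ((j i : ℂ) - β i)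
    rw [add_sub_cancel, Complex.norm_natCast] at h3
    exact h3
  have h4 := Finset.sum_le_sum fun i (_ : i ∈ Finset.univ) => h1 i
  rw [← Finset.sum_mul, Finset.sum_add_distrib, ← Finset.sum_mul] at h4
  unfold bracket mlen
  push_cast
  linarith

/-- A sup bound on $D_x^{(\beta)}$ bounds $j^{(\beta)}$ times the coefficient; conversely, rapid
decay makes the Fourier series of every $D_x^{(\beta)}$ derivative absolutely convergent. -/
lemma symbolS_iff (hΛ : IsWeight μ Λ) (hτ : ∀ k, SmoothTorus (τ k)) :
    SymbolS Λ ρ m τ ↔ ∀ α : Fin n → ℕ, DecayBound (fun k => Λ k ^ (m - ρ * (mlen α : ℝ)))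
      fun k j => diffMulti α (fun l => torusCoeff (τ l) j) k := by
  constructor
  · intro h α
    -- Falling factorials can vanish and cannot be divided out. The claim keeps $\beta$ arbitrary,
    -- so that one more bracket is traded for $\beta+e_i$; finally $\beta=0$.
    have key : ∀ (L : ℕ) (β : Fin n → ℕ), ∃ C : ℝ, 0 < C ∧ ∀ k j, bracket j ^ L *
        (‖fallMulti j β‖ * ‖diffMulti α (fun l => torusCoeff (τ l) j) k‖) ≤
          C * Λ k ^ (m - ρ * (mlen α : ℝ)) := by
      intro L
      induction L with
      | zero =>
        intro β
        obtain ⟨C, hC, hb⟩ := h.bound α β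
        refine ⟨C, hC, fun k j => ?_⟩
        have h1 := smooth_and_torusCoeff_diffMulti hτ α k
        have h2 := norm_torusCoeff_le (hb k) j
        rw [(smooth_and_torusCoeff_torusDMulti h1.1 β).2, h1.2, norm_mul] at h2
        simpa using h2
      | succ L ih =>
        intro β
        obtain ⟨C, hC, hb⟩ := ih β
        choose C' hC' hb' using fun i => ih (Pi.single i 1 + β)
        refine ⟨(1 + mlen β) * C + ∑ i, C' i, ?_, fun k j => ?_⟩
        · have : 0 ≤ ∑ i, C' i := Finset.sum_nonneg fun i _ => (hC' i).le
          positivity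
        · set d := ‖diffMulti α (fun l => torusCoeff (τ l) j) k‖ with hd
          have hd0 : 0 ≤ d := norm_nonneg _
          have hbj := pow_pos (bracket_pos j) L
          calc bracket j ^ (L + 1) * (‖fallMulti j β‖ * d)
              = bracket j ^ L * ((bracket j * ‖fallMulti j β‖) * d) := by ring
            _ ≤ bracket j ^ L * (((1 + mlen β) * ‖fallMulti j β‖ +
                ∑ i, ‖fallMulti j (Pi.single i 1 + β)‖) * d) := by
                gcongr
                exact bracket_mul_norm_fallMulti_le j β
            _ = (1 + mlen β) * (bracket j ^ L * (‖fallMulti j β‖ * d)) +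
                ∑ i, bracket j ^ L * (‖fallMulti j (Pi.single i 1 + β)‖ * d) := by
                rw [← Finset.mul_sum, ← Finset.sum_mul]
                ring
            _ ≤ (1 + mlen β) * (C * Λ k ^ (m - ρ * (mlen α : ℝ))) +
                ∑ i, C' i * Λ k ^ (m - ρ * (mlen α : ℝ)) :=
                add_le_add (mul_le_mul_of_nonneg_left (hb k j) (by positivity))
                  (Finset.sum_le_sum fun i _ => hb' i k j)
            _ = _ := by
                rw [← Finset.sum_mul]
                ring
    intro L
    obtain ⟨C, hC, hb⟩ := key L 0
    exact ⟨C, hC, fun k j => by simpa [fallMulti, fallFact_zero] using hb k j⟩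
  · intro h
    refine ⟨hτ, fun α β => ?_⟩
    obtain ⟨C, hC, hb⟩ := ((h α).mul_left (mlen β) fun j => norm_fallMulti_le j β) (0 + 2 * n)
    set S := ∑' j : Fin n → ℤ, (bracket j ^ (2 * n))⁻¹ with hS
    have hS0 : 0 ≤ S := tsum_nonneg fun j => inv_nonneg.2 (pow_nonneg (bracket_pos j).le _)
    refine ⟨C * (S + 1), by positivity, fun k x => ?_⟩
    have h1 := smooth_and_torusCoeff_diffMulti hτ α k
    obtain ⟨h2, h3⟩ := smooth_and_torusCoeff_torusDMulti h1.1 β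
    have h4 : ∀ j, ‖torusCoeff (torusDMulti β (diffMulti α τ k)) j‖ ≤
        C * Λ k ^ (m - ρ * (mlen α : ℝ)) * (bracket j ^ (2 * n))⁻¹ := fun j => by
      rw [h3, h1.2]
      simpa using norm_le_of_bracket_bound (hb k j)
    have h5 := (summable_bracket_inv n).mul_left (C * Λ k ^ (m - ρ * (mlen α : ℝ)))
    have h6 := Summable.of_nonneg_of_le (fun j => norm_nonneg _) h4 h5
    refine (norm_le_tsum_torusCoeff h2 h6 x).trans ((h6.tsum_le_tsum h4 h5).trans ?_)
    rw [tsum_mul_left, ← hS]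
    have := Real.rpow_pos_of_pos (hΛ.pos k) (m - ρ * (mlen α : ℝ))
    have : 0 < C * Λ k ^ (m - ρ * (mlen α : ℝ)) := by positivity
    linarith

lemma symbolM_iff (hΛ : IsWeight μ Λ) (hρ : 0 < ρ) (hτ : ∀ k, SmoothTorus (τ k)) :
    SymbolM Λ ρ m τ ↔ KernelClass Λ ρ m fun k => torusCoeff (τ k) := by
  have hsm : ∀ (γ : Fin n → ℕ) k, SmoothTorus fun x => (zpowMulti k γ : ℂ) * diffMulti γ τ k x :=
    fun γ k => (smooth_and_torusCoeff_diffMulti hτ γ k).1.const_mul _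
  have hS : ∀ γ : Fin n → ℕ, SymbolS Λ ρ m (fun k x => (zpowMulti k γ : ℂ) * diffMulti γ τ k x) ↔
      ∀ α, MixedBound Λ ρ m (fun k => torusCoeff (τ k)) α 0 γ := by
    intro γ
    rw [symbolS_iff hΛ (hsm γ)]
    simp only [torusCoeff_const_mul, (smooth_and_torusCoeff_diffMulti hτ γ _).2, MixedBound,
      add_zero, zero_add]
  rw [kernelClass_iff hΛ hρ]
  constructor
  · intro h α γ hγ
    exact (hS γ).1 (h.mem γ hγ) α
  · intro h
    exact ⟨hτ, fun γ hγ => (hS γ).2 fun α => h α γ hγ⟩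

lemma KernelClass.rapidlyDecreasing {a : (Fin n → ℤ) → (Fin n → ℤ) → ℂ}
    (ha : KernelClass Λ ρ m a) (k : Fin n → ℤ) : RapidlyDecreasing (a k) := by
  rw [rapidlyDecreasing_iff]
  intro L
  obtain ⟨C, hC, hb⟩ := ha 0 0 (by simp) L
  refine ⟨C * symWeight Λ (m - ρ * (mlen (0 : Fin n → ℕ) : ℝ)) 0 k, fun j => ?_⟩
  have := hb k j
  simp only [add_zero, diffMulti_zero] at this
  exact this

lemma KernelClass.exists_polynomial_bound (hΛ : IsWeight μ Λ)
    {a : (Fin n → ℤ) → (Fin n → ℤ) → ℂ} (ha : KernelClass Λ ρ m a) :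
    ∃ (C : ℝ) (q : ℕ), ∀ k j, ‖a k j‖ ≤ C * bracket k ^ q := by
  obtain ⟨C, hC, hb⟩ := ha 0 0 (by simp) 0
  obtain ⟨h0, A, hA, q, hω⟩ := moderate_symWeight hΛ (m - ρ * (mlen (0 : Fin n → ℕ) : ℝ)) 0
  refine ⟨C * (A * symWeight Λ (m - ρ * (mlen (0 : Fin n → ℕ) : ℝ)) 0 0), q, fun k j => ?_⟩
  have h1 := hb k j
  simp only [add_zero, diffMulti_zero, pow_zero, one_mul] at h1
  have h2 := hω 0 k
  rw [zero_add] at h2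
  refine h1.trans ((mul_le_mul_of_nonneg_left h2 hC.le).trans (le_of_eq ?_))
  ring

end Symbols

/-! ### The transpose -/

section Transpose

open MeasureTheory

variable {n : ℕ} {Λ : (Fin n → ℤ) → ℝ} {ρ μ m : ℝ}
  {σ τ : (Fin n → ℤ) → UnitAddTorus (Fin n) → ℂ}

lemma pdo_eq_tsum {f : (Fin n → ℤ) → ℂ} (hf : RapidlyDecreasing f) {k : Fin n → ℤ}
    (hτ : SmoothTorus (τ k)) : pdo τ f k = ∑' l, torusCoeff (τ k) (l - k) * f l := by
  have e : ∀ l x, UnitAddTorus.mFourier k x * τ k x * (UnitAddTorus.mFourier (-l) x * f l) =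
      UnitAddTorus.mFourier (-(l - k)) x * τ k x * f l := by
    intro l x
    rw [neg_sub, sub_eq_add_neg, UnitAddTorus.mFourier_add]
    ring
  have h1 := hasSum_integral_of_summable_integral_norm (μ := haarTorus n)
    (F := fun l x => UnitAddTorus.mFourier k x * τ k x * (UnitAddTorus.mFourier (-l) x * f l))
    (fun l => by
      simp only [e]
      exact (integrable_mFourier_mul hτ _).mul_const _) (by
      simp only [norm_mul, norm_mFourier_apply, one_mul, integral_mul_const]
      exact hf.summable_norm.mul_left _)
  simp only [e, integral_mul_const] at h1
  simp only [← e, tsum_mul_left] at h1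
  exact h1.tsum_eq.symm

lemma rapidlyDecreasing_single (k : Fin n → ℤ) :
    RapidlyDecreasing (Pi.single k 1 : (Fin n → ℤ) → ℂ) := by
  intro M
  refine ⟨(1 + znorm k) ^ M, fun l => ?_⟩
  have := znorm_nonneg k
  by_cases h : l = k
  · subst h
    simp
  · simp [h]
    positivity

/-- Taking $g$ to be a point mass at $k$ reads off the value at $k$. -/
lemma IsTranspose.eq {A B B' : ((Fin n → ℤ) → ℂ) → (Fin n → ℤ) → ℂ} (h : IsTranspose A B)
    (h' : IsTranspose A B') {f : (Fin n → ℤ) → ℂ} (hf : RapidlyDecreasing f) : B f = B' f := by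
  ext k
  have h1 := (h f _ hf (rapidlyDecreasing_single k)).2.2.trans
    (h' f _ hf (rapidlyDecreasing_single k)).2.2.symm
  rw [tsum_eq_single k fun l hl => by simp [hl], tsum_eq_single k fun l hl => by simp [hl]] at h1
  simpa using h1

/-- The rapid decay of $f$ absorbs the polynomial growth of the coefficients, so the double series
is absolutely summable and the sums may be interchanged. -/
lemma isTranspose_pdo (hσ : ∀ k, SmoothTorus (σ k)) (hτ : ∀ k, SmoothTorus (τ k)) {C : ℝ} {q : ℕ}
    (hb : ∀ k j, ‖torusCoeff (σ k) j‖ ≤ C * bracket k ^ q)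
    (h : ∀ k j, torusCoeff (τ k) j = torusCoeff (σ (k + j)) (-j)) :
    IsTranspose (pdo σ) (pdo τ) := by
  intro f g hf hg
  set G : (Fin n → ℤ) × (Fin n → ℤ) → ℂ := fun p =>
    f p.1 * (torusCoeff (σ p.1) (p.2 - p.1) * g p.2) with hG
  have hsum : Summable G := by
    have hC : 0 ≤ C := nonneg_of_mul_nonneg_left ((norm_nonneg _).trans (hb 0 0))
      (pow_pos (bracket_pos _) _)
    have h1 : Summable fun p : (Fin n → ℤ) × (Fin n → ℤ) =>
        C * (bracket p.1 ^ q * ‖f p.1‖) * ‖g p.2‖ :=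
      ((hf.summable_bracket_mul q).mul_left C).mul_of_nonneg hg.summable_norm
        (fun k => mul_nonneg hC (mul_nonneg (pow_nonneg (bracket_pos k).le _) (norm_nonneg _)))
        fun k => norm_nonneg _
    refine Summable.of_norm (Summable.of_nonneg_of_le (fun _ => norm_nonneg _) (fun p => ?_) h1)
    simp only [hG, norm_mul]
    calc ‖f p.1‖ * (‖torusCoeff (σ p.1) (p.2 - p.1)‖ * ‖g p.2‖)
        ≤ ‖f p.1‖ * (C * bracket p.1 ^ q * ‖g p.2‖) := by
          gcongr
          exact hb _ _
      _ = C * (bracket p.1 ^ q * ‖f p.1‖) * ‖g p.2‖ := by ring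
  have e1 : ∀ k, f k * pdo σ g k = ∑' l, G (k, l) := fun k => by
    rw [pdo_eq_tsum hg (hσ k), ← tsum_mul_left]
  have e2 : ∀ k, pdo τ f k * g k = ∑' l, G (l, k) := fun k => by
    rw [pdo_eq_tsum hf (hτ k), ← tsum_mul_right]
    refine tsum_congr fun l => ?_
    rw [h, add_sub_cancel, neg_sub]
    simp only [hG]
    ring
  simp only [e1, e2]
  exact ⟨hsum.prod_symm.prod, hsum.prod, Summable.tsum_comm (f := fun k l => G (k, l)) hsum⟩

/-- The symbol of the transpose operator. -/
def transposeSymbol (σ : (Fin n → ℤ) → UnitAddTorus (Fin n) → ℂ) (k : Fin n → ℤ) :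
    UnitAddTorus (Fin n) → ℂ :=
  torusSeries fun j => torusCoeff (σ (k + j)) (-j)

lemma KernelClass.reflect {a : (Fin n → ℤ) → (Fin n → ℤ) → ℂ} (ha : KernelClass Λ ρ m a) :
    KernelClass Λ ρ m fun k j => a k (-j) :=
  fun α γ hγ => (ha α γ hγ).reflect

/-- The Newton expansion with $N=0$: no terms are subtracted and no order is lost. -/
lemma KernelClass.shear (hΛ : IsWeight μ Λ) (hρ : 0 < ρ) {a : (Fin n → ℤ) → (Fin n → ℤ) → ℂ}
    (ha : KernelClass Λ ρ m a) : KernelClass Λ ρ m fun k j => a (k + j) j := by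
  have h := opOrder_newton hΛ hρ 0 m a ha
  have e : multiIdxLT n 0 = ∅ := by
    simp [multiIdxLT]
  simp only [e, Finset.sum_empty, sub_zero, shiftAlg_single, one_mul, Nat.cast_zero, mul_zero] at h
  exact h


lemma SymbolM.kernelClass_reflect (hΛ : IsWeight μ Λ) (hρ : 0 < ρ) (hσ : SymbolM Λ ρ m σ) :
    KernelClass Λ ρ m fun k j => torusCoeff (σ k) (-j) :=
  ((symbolM_iff hΛ hρ hσ.smooth).1 hσ).reflect

lemma rapidlyDecreasing_transposeCoeff (hΛ : IsWeight μ Λ) (hρ : 0 < ρ) (hσ : SymbolM Λ ρ m σ)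
    (k : Fin n → ℤ) : RapidlyDecreasing fun j => torusCoeff (σ (k + j)) (-j) :=
  ((hσ.kernelClass_reflect hΛ hρ).shear hΛ hρ).rapidlyDecreasing k

lemma smoothTorus_transposeSymbol (hΛ : IsWeight μ Λ) (hρ : 0 < ρ) (hσ : SymbolM Λ ρ m σ)
    (k : Fin n → ℤ) : SmoothTorus (transposeSymbol σ k) :=
  smoothTorus_torusSeries (rapidlyDecreasing_transposeCoeff hΛ hρ hσ k)

lemma torusCoeff_transposeSymbol (hΛ : IsWeight μ Λ) (hρ : 0 < ρ) (hσ : SymbolM Λ ρ m σ)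
    (k j : Fin n → ℤ) : torusCoeff (transposeSymbol σ k) j = torusCoeff (σ (k + j)) (-j) :=
  torusCoeff_torusSeries (rapidlyDecreasing_transposeCoeff hΛ hρ hσ k) j

lemma symbolM_transposeSymbol (hΛ : IsWeight μ Λ) (hρ : 0 < ρ) (hσ : SymbolM Λ ρ m σ) :
    SymbolM Λ ρ m (transposeSymbol σ) := by
  rw [symbolM_iff hΛ hρ (smoothTorus_transposeSymbol hΛ hρ hσ)]
  have e : (fun k => torusCoeff (transposeSymbol σ k)) =
      fun k j => torusCoeff (σ (k + j)) (-j) := by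
    ext k j
    exact torusCoeff_transposeSymbol hΛ hρ hσ k j
  rw [e]
  exact (hσ.kernelClass_reflect hΛ hρ).shear hΛ hρ

/-! ### The asymptotic expansion -/

lemma smooth_and_torusCoeff_asymptotic_term (hσ : ∀ k, SmoothTorus (σ k)) (α : Fin n → ℕ)
    (k : Fin n → ℤ) :
    SmoothTorus (diffMulti α (fun l => torusDMulti α fun y => σ l (-y)) k) ∧
      ∀ j, torusCoeff (diffMulti α (fun l => torusDMulti α fun y => σ l (-y)) k) j =
        fallMulti j α * shiftAlg (diffMultiElt α) (fun l => torusCoeff (σ l) (-j)) k := by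
  have h1 : ∀ l, SmoothTorus fun y => σ l (-y) := fun l => (hσ l).comp_neg
  have h2 := smooth_and_torusCoeff_diffMulti
    (fun l => (smooth_and_torusCoeff_torusDMulti (h1 l) α).1) α k
  refine ⟨h2.1, fun j => ?_⟩
  rw [h2.2]
  have e : (fun l => torusCoeff (torusDMulti α fun y => σ l (-y)) j) =
      fallMulti j α • fun l => torusCoeff (σ l) (-j) := by
    ext l
    rw [(smooth_and_torusCoeff_torusDMulti (h1 l) α).2, torusCoeff_comp_neg]
    rfl
  rw [e, diffMulti_eq_shiftAlg, map_smul]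
  rfl

/-- The coefficients of this difference are exactly the Newton remainder applied to the reflected
kernel $a(k,-j)$. -/
lemma symbolM_transposeSymbol_sub (hΛ : IsWeight μ Λ) (hρ : 0 < ρ) (hσ : SymbolM Λ ρ m σ)
    (N : ℕ) : SymbolM Λ ρ (m - ρ * (N : ℝ)) fun k x =>
      transposeSymbol σ k x - ∑ α ∈ multiIdxLT n N, ((mfact α : ℂ))⁻¹ *
        diffMulti α (fun l => torusDMulti α fun y => σ l (-y)) k x := by
  have hterm := fun α k => smooth_and_torusCoeff_asymptotic_term hσ.smooth α k
  have hsum : ∀ k, SmoothTorus fun x => ∑ α ∈ multiIdxLT n N, ((mfact α : ℂ))⁻¹ *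
      diffMulti α (fun l => torusDMulti α fun y => σ l (-y)) k x := fun k =>
    SmoothTorus.sum _ fun α _ => (hterm α k).1.const_mul _
  have htr := smoothTorus_transposeSymbol hΛ hρ hσ
  refine (symbolM_iff hΛ hρ fun k => (htr k).sub (hsum k)).2 ?_
  have h := opOrder_newton hΛ hρ N m _ (hσ.kernelClass_reflect hΛ hρ)
  convert h using 1
  ext k j
  have h1 := torusCoeff_sub (htr k) (hsum k) j
  rw [torusCoeff_sum _ fun α _ => (hterm α k).1.const_mul _,
    torusCoeff_transposeSymbol hΛ hρ hσ] at h1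
  refine h1.trans ?_
  simp only [torusCoeff_const_mul, (hterm _ k).2]
  simp [shiftAlg_single, mul_assoc]

lemma isTranspose_transposeSymbol (hΛ : IsWeight μ Λ) (hρ : 0 < ρ) (hσ : SymbolM Λ ρ m σ) :
    IsTranspose (pdo σ) (pdo (transposeSymbol σ)) := by
  obtain ⟨C, q, hb⟩ := ((symbolM_iff hΛ hρ hσ.smooth).1 hσ).exists_polynomial_bound hΛ
  exact isTranspose_pdo hσ.smooth (smoothTorus_transposeSymbol hΛ hρ hσ) hb
    (torusCoeff_transposeSymbol hΛ hρ hσ)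

end Transpose

end

end LatticePDO

theorem mainTheorem8 (n : ℕ) (μ : ℝ) (Λ : (Fin n → ℤ) → ℝ) (hΛ : IsWeight μ Λ)
    (ρ : ℝ) (hρ : 0 < ρ) (hρμ : ρ ≤ 1 / μ) (m : ℝ)
    (σ : (Fin n → ℤ) → UnitAddTorus (Fin n) → ℂ) (hσ : SymbolM Λ ρ m σ) :
    ∃ σt : (Fin n → ℤ) → UnitAddTorus (Fin n) → ℂ,
      SymbolM Λ ρ m σt ∧
      IsTranspose (pdo σ) (pdo σt) ∧
      (∀ B : ((Fin n → ℤ) → ℂ) → (Fin n → ℤ) → ℂ, IsTranspose (pdo σ) B →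
        ∀ f, RapidlyDecreasing f → B f = pdo σt f) ∧
      ∀ N : ℕ, SymbolM Λ ρ (m - ρ * (N : ℝ)) fun k x =>
        σt k x - ∑ α ∈ multiIdxLT n N, ((mfact α : ℂ))⁻¹ *
          diffMulti α (fun l => torusDMulti α fun y => σ l (-y)) k x := by
  exact ⟨transposeSymbol σ, symbolM_transposeSymbol hΛ hρ hσ, isTranspose_transposeSymbol hΛ hρ hσ,
    fun _ hB _ hf => hB.eq (isTranspose_transposeSymbol hΛ hρ hσ) hf,
    symbolM_transposeSymbol_sub hΛ hρ hσ⟩
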